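/- \textbf{Setting.} Let $(\Omega,\mathcal B,\mathbf P)$ be a standard probability space (that is, after removal of a null set, $\mathcal B$ contains a standard Borel $\sigma$-field and is contained in its completion), and let $T:\Omega\to\Omega$ be an ergodic measure-preserving bijection with $T$ and $T^{-1}$ measurable. For a $\sigma$-field $\mathcal Y\subseteq\mathcal B$ put $\mathcal Y_{0,n}=\bigvee_{k=0}^{n}T^{-k}\mathcal Y$. The system $(\Omega,\mathcal B,\mathbf P,T)$ is \emph{conditionally weak mixing relative to} $\mathcal Y$ if for all $A,B\in\mathcal B$ $$\frac1N\sum_{k=1}^N\big|\mathbf P[A\cap T^kB\,|\,\mathcal Y]-\mathbf P[A|\mathcal Y]\,\mathbf P[T^kB|\mathcal Y]\big|\xrightarrow{N\to\infty}0\quad\text{in }L^1,$$ and \emph{weak mixing} if for all $A,B\in\mathcal B$ $$\frac1N\sum_{k=1}^N\big|\mathbf P[T^{-k}A\cap B]-\mathbf P[A]\,\mathbf P[B]\big|\xrightarrow{N\to\infty}0.$$ A \emph{bounded loss with finite decision space} is a bounded measurable function $\ell:U\times\Omega\to\mathbb R$, where $U$ is a nonempty finite measurable space. An \emph{admissible strategy}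 is a sequence $\mathbf u=(u_k)_{k\ge1}$ of $\mathcal Y_{0,k}$-measurable maps $u_k:\Omega\to U$; its time-average loss is $L_N(\mathbf u)(\omega)=\frac1N\sum_{k=1}^N\ell(u_k(\omega),T^k\omega)$. An admissible strategy $\mathbf u^\star$ is \emph{weakly pathwise optimal} if for every admissible strategy $\mathbf u$ and every $\varepsilon>0$ $$\mathbf P\big[L_N(\mathbf u)-L_N(\mathbf u^\star)\ge-\varepsilon\big]\xrightarrow{N\to\infty}1.$$ \textbf{Theorem.} Let $\mathcal Y\subseteq\mathcal B$ be an invariant $\sigma$-field, that is, $T^{-1}\mathcal Y=\mathcal Y$. Then the following are equivalent: \begin{enumerate} \item $(\Omega,\mathcal B,\mathbf P,T)$ is conditionally weak mixing relative to $\mathcal Y$. \item For every bounded loss with finite decision space there exists a weakly pathwise optimal strategy. \end{enumerate} In particular, $(\Omega,\mathcal B,\mathbf P,T)$ is weak mixing if and only if, when $\mathcal Y=\{\varnothing,\Omega\}$ is the trivial $\sigma$-field (blind decisions), for every bounded loss with finite decision space there exists a weakly pathwise optimal strategy. -/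

import Mathlib

open MeasureTheory ProbabilityTheory Filter Topology

universe u v

noncomputable section

variable {Ω : Type u} {U : Type v}

/-- A probability space `(Ω, ℬ, P)` is standard if, after removal of a null set, its σ-field contains
a standard Borel σ-field and is contained in the completion of that σ-field.  This covers both
standard Borel spaces with a Borel probability measure and their completions (Lebesgue-Rokhlin
spaces). -/
def IsStandardProbabilitySpace {mΩ : MeasurableSpace Ω} (P : Measure Ω) : Prop :=
  IsProbabilityMeasure P ∧
    ∃ S : Set Ω, MeasurableSet S ∧ P Sᶜ = 0 ∧
      ∃ 𝒢 : MeasurableSpace S,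
        𝒢 ≤ mΩ.comap Subtype.val ∧
        @StandardBorelSpace S 𝒢 ∧
        ∀ A : Set S, MeasurableSet[mΩ.comap Subtype.val] A →
          ∃ G : Set S, MeasurableSet[𝒢] G ∧ P (Subtype.val '' (symmDiff A G)) = 0

/-- Conditional weak mixing of `(Ω, ℬ, P, T)` relative to `𝒵`: for all `A, B ∈ ℬ`,
`N⁻¹ ∑_{k=1}^N |P[A ∩ TᵏB | 𝒵] - P[A | 𝒵] P[TᵏB | 𝒵]| → 0` in `L¹`. -/
def IsCondWeakMixing (𝒵 : MeasurableSpace Ω) {mΩ : MeasurableSpace Ω} (T : Ω → Ω)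
    (P : Measure Ω) : Prop :=
  ∀ A B : Set Ω, MeasurableSet[mΩ] A → MeasurableSet[mΩ] B →
    Tendsto
      (fun N : ℕ => eLpNorm
        (fun ω => (1 / (N : ℝ)) * ∑ k ∈ Finset.Icc 1 N,
          |(P⟦A ∩ T^[k] '' B|𝒵⟧) ω - (P⟦A|𝒵⟧) ω * (P⟦T^[k] '' B|𝒵⟧) ω|) 1 P)
      atTop (𝓝 0)

/-- Weak mixing: `N⁻¹ ∑_{k=1}^N |P(T⁻ᵏA ∩ B) - P(A) P(B)| → 0` for all measurable `A, B`. -/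
def IsWeakMixing {mΩ : MeasurableSpace Ω} (T : Ω → Ω) (P : Measure Ω) : Prop :=
  ∀ A B : Set Ω, MeasurableSet A → MeasurableSet B →
    Tendsto
      (fun N : ℕ => (1 / (N : ℝ)) * ∑ k ∈ Finset.Icc 1 N,
        |P.real (T^[k] ⁻¹' A ∩ B) - P.real A * P.real B|)
      atTop (𝓝 0)

/-- `𝒴_{0,n} = ⋁_{k=0}^n T⁻ᵏ𝒴`, the information observed in the time interval `[0, n]`. -/
abbrev observedField (𝒴 : MeasurableSpace Ω) (T : Ω → Ω) (n : ℕ) : MeasurableSpace Ω :=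
  ⨆ k ∈ Finset.Icc 0 n, 𝒴.comap T^[k]

/-- A strategy `(u_k)_{k ≥ 1}` (the value at `k = 0` is irrelevant) is admissible if `u_k` is
`𝒴_{0,k}`-measurable for every `k ≥ 1`. -/
def IsAdmissible (𝒴 : MeasurableSpace Ω) [mU : MeasurableSpace U] (T : Ω → Ω)
    (s : ℕ → Ω → U) : Prop :=
  ∀ k, 1 ≤ k → Measurable[observedField 𝒴 T k, mU] (s k)

/-- The time-average loss `N⁻¹ ∑_{k=1}^N ℓ(u_k, Tᵏω)`. -/
def averageLoss (T : Ω → Ω) (ℓ : U × Ω → ℝ) (s : ℕ → Ω → U) (N : ℕ) (ω : Ω) : ℝ :=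
  (1 / (N : ℝ)) * ∑ k ∈ Finset.Icc 1 N, ℓ (s k ω, T^[k] ω)

/-- Weak pathwise optimality of the strategy `sStar`: it is admissible, and for every admissible
strategy `s` and `ε > 0`, `P[L_N(s) - L_N(sStar) ≥ -ε] → 1` as `N → ∞`. -/
def IsWeaklyPathwiseOptimal (𝒴 : MeasurableSpace Ω) {mΩ : MeasurableSpace Ω}
    [mU : MeasurableSpace U] (T : Ω → Ω) (P : Measure Ω) (ℓ : U × Ω → ℝ)
    (sStar : ℕ → Ω → U) : Prop :=
  IsAdmissible 𝒴 T sStar ∧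
    ∀ s : ℕ → Ω → U, IsAdmissible 𝒴 T s → ∀ ε : ℝ, 0 < ε →
      Tendsto
        (fun N : ℕ => P {ω | averageLoss T ℓ s N ω - averageLoss T ℓ sStar N ω ≥ -ε})
        atTop (𝓝 1)

/-- Every bounded measurable loss function with a (nonempty) finite decision space admits a weakly
pathwise optimal strategy. -/
def EveryFiniteLossHasOptimal (𝒴 : MeasurableSpace Ω) {mΩ : MeasurableSpace Ω} (T : Ω → Ω)
    (P : Measure Ω) : Prop :=
  ∀ (U : Type v) [mU : MeasurableSpace U] [Finite U] [Nonempty U],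
    ∀ ℓ : U × Ω → ℝ, Measurable[mU.prod mΩ] ℓ →
      (∃ C : ℝ, ∀ (a : U) (ω : Ω), |ℓ (a, ω)| ≤ C) →
        ∃ sStar : ℕ → Ω → U, IsWeaklyPathwiseOptimal 𝒴 T P ℓ sStar

end

/-! Since `𝒴` is invariant, every `observedField 𝒴 T k` equals `𝒴`, so a strategy is just a sequence
of `𝒴`-measurable decisions, and conditional expectation given `𝒴` commutes with `T`. Both
properties then become statements about averages of `w k · f ∘ T^[k]` with `𝒴`-measurable weights
and `f` conditionally centered.

Mixing gives optimality. The second moment of such an average is at most the double average of the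
`L¹` norms of the conditional autocovariances, uniformly in the weights. By stationarity these norms
depend only on the time difference, so mixing makes them vanish on average; density extends this
from indicators to all integrable functions (`IsCondWeakMixing.hasVanishingWeightedAverages`). Hence
the loss of any strategy is `L¹`-close to its average conditional expected loss, and minimizing the
latter pointwise is optimal.

Optimality gives mixing. For the loss "bet or do not bet on `f`", with `f` a centered indicator,
every strategy has mean loss zero. Differences from the optimal strategy are centered and
asymptotically nonnegative, hence vanish in `L¹`; comparison with never betting shows that every
strategy has vanishing loss (`EveryFiniteLossHasOptimal.tendsto_integral_abs_average`). The test
strategy is a copy of the itinerary of `A`, conditionally independent of the original given `𝒴`: its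
mean squared loss dominates the double average of the squared conditional covariances
(`EveryFiniteLossHasOptimal.tendsto_average_sq_condCov`). A duality argument with sign weights
passes from autocovariances to covariances with arbitrary sets. -/

/-! ### Invariance of `𝒴` and conditional expectation. -/

theorem comap_iterate_eq {Ω : Type u} {𝒴 : MeasurableSpace Ω} {T : Ω → Ω}
    (h : 𝒴.comap T = 𝒴) (n : ℕ) : 𝒴.comap T^[n] = 𝒴 := by
  induction n with
  | zero => simp [MeasurableSpace.comap_id]
  | succ n ih => rw [Function.iterate_succ, ← MeasurableSpace.comap_comp, ih, h]

theorem measurable_iterate_of_comap_eq {Ω : Type u} {𝒴 : MeasurableSpace Ω} {T : Ω → Ω}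
    (h : 𝒴.comap T = 𝒴) (n : ℕ) : Measurable[𝒴, 𝒴] T^[n] :=
  measurable_iff_comap_le.2 (comap_iterate_eq h n).le

theorem observedField_eq_of_comap_eq {Ω : Type u} {𝒴 : MeasurableSpace Ω} {T : Ω → Ω}
    (h : 𝒴.comap T = 𝒴) (n : ℕ) : observedField 𝒴 T n = 𝒴 := by
  simp only [observedField, comap_iterate_eq h]
  exact le_antisymm (iSup₂_le fun _ _ => le_rfl) (le_iSup₂_of_le 0 (by simp) le_rfl)

theorem comap_symm_eq_of_comap_eq {Ω : Type u} {𝒴 mΩ : MeasurableSpace Ω} {T : Ω ≃ᵐ Ω}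
    (h : 𝒴.comap T = 𝒴) : 𝒴.comap T.symm = 𝒴 := by
  conv_lhs => rw [← h]
  rw [MeasurableSpace.comap_comp]
  simp [MeasurableSpace.comap_id]

theorem integrable_of_abs_le {Ω : Type u} {mΩ : MeasurableSpace Ω} {P : Measure Ω}
    [IsFiniteMeasure P] {f : Ω → ℝ} {C : ℝ} (hf : Measurable f) (h : ∀ ω, |f ω| ≤ C) :
    Integrable f P :=
  Integrable.of_bound hf.aestronglyMeasurable C (Eventually.of_forall h)

/-- Conditional expectation given an invariant σ-field commutes with a measure-preserving map. -/
theorem condExp_comp_of_comap_eq {Ω : Type u} {𝒴 mΩ : MeasurableSpace Ω} {P : Measure Ω}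
    [IsFiniteMeasure P] (h𝒴 : 𝒴 ≤ mΩ) {S : Ω → Ω} (hS : MeasurePreserving S P P)
    (h : 𝒴.comap S = 𝒴) {X : Ω → ℝ} (hX : Integrable X P) :
    P[X ∘ S|𝒴] =ᵐ[P] (P[X|𝒴]) ∘ S := by
  have hY : Integrable ((P[X|𝒴]) ∘ S) P := hS.integrable_comp_of_integrable integrable_condExp
  refine (ae_eq_condExp_of_forall_setIntegral_eq h𝒴 (hS.integrable_comp_of_integrable hX)
    (fun s _ _ => hY.integrableOn) ?_ ?_).symm
  · intro s hs _
    rw [← h] at hs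
    obtain ⟨t, ht, rfl⟩ := hs
    have key : ∀ Z : Ω → ℝ, Integrable Z P →
        ∫ ω in S ⁻¹' t, (Z ∘ S) ω ∂P = ∫ ω in t, Z ω ∂P := by
      intro Z hZ
      have := (hS.restrict_preimage (h𝒴 t ht)).map_eq
      rw [← this, integral_map hS.measurable.aemeasurable]
      · rfl
      · rw [this]; exact hZ.1.restrict
    rw [key _ integrable_condExp, key _ hX, setIntegral_condExp h𝒴 hX ht]
  · exact (stronglyMeasurable_condExp.comp_measurable
      (measurable_iff_comap_le.2 h.le)).aestronglyMeasurable

theorem integral_abs_condExp_comp {Ω : Type u} {𝒴 mΩ : MeasurableSpace Ω} {P : Measure Ω}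
    [IsFiniteMeasure P] (h𝒴 : 𝒴 ≤ mΩ) {S : Ω → Ω} (hS : MeasurePreserving S P P)
    (h : 𝒴.comap S = 𝒴) {X : Ω → ℝ} (hX : Integrable X P) :
    ∫ ω, |(P[X ∘ S|𝒴]) ω| ∂P = ∫ ω, |(P[X|𝒴]) ω| ∂P := by
  have hi : Integrable (fun ω => |(P[X|𝒴]) ω|) P := integrable_condExp.abs
  calc _ = ∫ ω, |(P[X|𝒴]) (S ω)| ∂P := by
        refine integral_congr_ae ?_
        filter_upwards [condExp_comp_of_comap_eq h𝒴 hS h hX] with ω hω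
        rw [hω]; rfl
    _ = _ := by
        have := integral_map (μ := P) hS.measurable.aemeasurable
          (f := fun ω => |(P[X|𝒴]) ω|) (by rw [hS.map_eq]; exact hi.1)
        rw [← this, hS.map_eq]

theorem integral_mul_condExp {Ω : Type u} {𝒴 mΩ : MeasurableSpace Ω} {P : Measure Ω}
    [IsFiniteMeasure P] (h𝒴 : 𝒴 ≤ mΩ) {w X : Ω → ℝ} {C : ℝ} (hw : Measurable[𝒴] w)
    (hC : ∀ ω, |w ω| ≤ C) (hX : Integrable X P) :
    ∫ ω, w ω * (P[X|𝒴]) ω ∂P = ∫ ω, w ω * X ω ∂P := by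
  have h1 : Integrable (w * X) P :=
    hX.bdd_mul (hw.mono h𝒴 le_rfl).aestronglyMeasurable (Eventually.of_forall hC)
  have := condExp_mul_of_stronglyMeasurable_left (m := 𝒴) hw.stronglyMeasurable h1 hX
  calc _ = ∫ ω, (P[w * X|𝒴]) ω ∂P := (integral_congr_ae this).symm
    _ = ∫ ω, (w * X) ω ∂P := integral_condExp h𝒴
    _ = _ := rfl

theorem abs_mul_le_one {a b : ℝ} (ha : |a| ≤ 1) (hb : |b| ≤ 1) : |a * b| ≤ 1 := by
  rw [abs_mul]; exact mul_le_one₀ ha (abs_nonneg _) hb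

/-! ### Second moments and stationarity of conditional covariances. -/

/-- The second moment of a sum with weights measurable with respect to the conditioning field. -/
theorem integral_sq_sum_eq {Ω : Type u} {𝒴 mΩ : MeasurableSpace Ω} {P : Measure Ω}
    [IsFiniteMeasure P] (h𝒴 : 𝒴 ≤ mΩ) {s b : ℕ → Ω → ℝ} (hs : ∀ k, Measurable[𝒴] (s k))
    (hs1 : ∀ k ω, |s k ω| ≤ 1) (hb : ∀ k, Measurable (b k)) (hb1 : ∀ k ω, |b k ω| ≤ 1)
    (I : Finset ℕ) :
    ∫ ω, (∑ k ∈ I, s k ω * b k ω) ^ 2 ∂P =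
      ∑ j ∈ I, ∑ k ∈ I, ∫ ω, s j ω * s k ω * (P[fun ω => b j ω * b k ω|𝒴]) ω ∂P := by
  have hbb : ∀ j k, Integrable (fun ω => b j ω * b k ω) P := fun j k =>
    integrable_of_abs_le ((hb j).mul (hb k)) fun ω => abs_mul_le_one (hb1 j ω) (hb1 k ω)
  have hss : ∀ j k ω, |s j ω * s k ω| ≤ 1 := fun j k ω => abs_mul_le_one (hs1 j ω) (hs1 k ω)
  have hsm : ∀ j k, Measurable[𝒴] fun ω => s j ω * s k ω := fun j k => (hs j).mul (hs k)
  have hint : ∀ j k, Integrable (fun ω => s j ω * s k ω * (b j ω * b k ω)) P := fun j k =>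
    (hbb j k).bdd_mul ((hsm j k).mono h𝒴 le_rfl).aestronglyMeasurable
      (Eventually.of_forall (hss j k))
  calc _ = ∫ ω, ∑ j ∈ I, ∑ k ∈ I, s j ω * s k ω * (b j ω * b k ω) ∂P := by
        refine integral_congr_ae (Eventually.of_forall fun ω => ?_)
        simp only [sq, Finset.sum_mul_sum]
        exact Finset.sum_congr rfl fun j _ => Finset.sum_congr rfl fun k _ => by ring
    _ = _ := by
        rw [integral_finsetSum _ fun j _ => integrable_finsetSum _ fun k _ => hint j k]
        refine Finset.sum_congr rfl fun j _ => ?_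
        rw [integral_finsetSum _ fun k _ => hint j k]
        exact Finset.sum_congr rfl fun k _ =>
          (integral_mul_condExp h𝒴 (hsm j k) (hss j k) (hbb j k)).symm

/-- The bound no longer contains the weights, so it controls all strategies at once. -/
theorem integral_sq_sum_le {Ω : Type u} {𝒴 mΩ : MeasurableSpace Ω} {P : Measure Ω}
    [IsFiniteMeasure P] (h𝒴 : 𝒴 ≤ mΩ) {s b : ℕ → Ω → ℝ} (hs : ∀ k, Measurable[𝒴] (s k))
    (hs1 : ∀ k ω, |s k ω| ≤ 1) (hb : ∀ k, Measurable (b k)) (hb1 : ∀ k ω, |b k ω| ≤ 1)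
    (I : Finset ℕ) :
    ∫ ω, (∑ k ∈ I, s k ω * b k ω) ^ 2 ∂P ≤
      ∑ j ∈ I, ∑ k ∈ I, ∫ ω, |(P[fun ω => b j ω * b k ω|𝒴]) ω| ∂P := by
  rw [integral_sq_sum_eq h𝒴 hs hs1 hb hb1]
  refine Finset.sum_le_sum fun j _ => Finset.sum_le_sum fun k _ => ?_
  refine integral_mono ?_ integrable_condExp.abs fun ω => ?_
  · exact integrable_condExp.bdd_mul
      (((hs j).mul (hs k)).mono h𝒴 le_rfl).aestronglyMeasurable
      (Eventually.of_forall fun ω => abs_mul_le_one (hs1 j ω) (hs1 k ω))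
  · refine (le_abs_self _).trans ?_
    rw [abs_mul]
    exact mul_le_of_le_one_left (abs_nonneg _) (abs_mul_le_one (hs1 j ω) (hs1 k ω))

/-- Conditional covariances along an orbit depend only on the absolute time difference. -/
theorem integral_abs_condExp_iterate_mul_eq {Ω : Type u} {𝒴 mΩ : MeasurableSpace Ω}
    {P : Measure Ω} [IsFiniteMeasure P] (h𝒴 : 𝒴 ≤ mΩ) {T : Ω ≃ᵐ Ω}
    (hT : MeasurePreserving T P P) (h : 𝒴.comap T = 𝒴) {f : Ω → ℝ} (hf : Measurable f)
    (hf1 : ∀ ω, |f ω| ≤ 1) (j m : ℕ) :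
    ∫ ω, |(P[fun ω => f (T^[j] ω) * f (T^[j + m] ω)|𝒴]) ω| ∂P =
      ∫ ω, |(P[fun ω => f ω * f (T.symm^[m] ω)|𝒴]) ω| ∂P := by
  have hX : Integrable (fun ω => f ω * f (T.symm^[m] ω)) P :=
    integrable_of_abs_le (hf.mul (hf.comp (T.symm.measurable.iterate m)))
      fun ω => abs_mul_le_one (hf1 _) (hf1 _)
  -- Shifting by `T^[j + m]` turns the times `0` and `-m` into `j + m` and `j`.
  rw [← integral_abs_condExp_comp h𝒴 (hT.iterate (j + m)) (comap_iterate_eq h _) hX]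
  have hl : Function.LeftInverse T.symm^[m] T^[m] :=
    Function.LeftInverse.iterate T.symm_apply_apply m
  congr! 5 with ω
  simp only [Function.comp]
  rw [mul_comm, add_comm j m, Function.iterate_add_apply, hl]

/-- Shifting by `T^[j + k]` exchanges the times `-j`, `-k` for `k`, `j`. This reconciles the sets
`TᵏB` of the mixing condition, which involve `T.symm`, with losses, which are evaluated at `Tᵏω`. -/
theorem integral_abs_condExp_symm_iterate_mul_eq {Ω : Type u} {𝒴 mΩ : MeasurableSpace Ω}
    {P : Measure Ω} [IsFiniteMeasure P] (h𝒴 : 𝒴 ≤ mΩ) {T : Ω ≃ᵐ Ω}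
    (hT : MeasurePreserving T P P) (h : 𝒴.comap T = 𝒴) {f : Ω → ℝ} (hf : Measurable f)
    (hf1 : ∀ ω, |f ω| ≤ 1) (j k : ℕ) :
    ∫ ω, |(P[fun ω => f (T.symm^[j] ω) * f (T.symm^[k] ω)|𝒴]) ω| ∂P =
      ∫ ω, |(P[fun ω => f (T^[j] ω) * f (T^[k] ω)|𝒴]) ω| ∂P := by
  have hX : Integrable (fun ω => f (T.symm^[j] ω) * f (T.symm^[k] ω)) P :=
    integrable_of_abs_le ((hf.comp (T.symm.measurable.iterate j)).mul
      (hf.comp (T.symm.measurable.iterate k))) fun ω => abs_mul_le_one (hf1 _) (hf1 _)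
  rw [← integral_abs_condExp_comp h𝒴 (hT.iterate (j + k)) (comap_iterate_eq h _) hX]
  have hl : ∀ m, Function.LeftInverse T.symm^[m] T^[m] :=
    Function.LeftInverse.iterate T.symm_apply_apply
  congr! 5 with ω
  simp only [Function.comp]
  rw [Function.iterate_add_apply, hl, ← Function.iterate_add_apply, add_comm j k,
    Function.iterate_add_apply, hl, mul_comm]

/-! ### Elementary estimates for Cesàro averages. -/

theorem tendsto_zero_of_le_add_div {a S : ℕ → ℝ} (h0 : ∀ N, 0 ≤ a N)
    (h : ∀ ε > 0, ∀ N, a N ≤ ε + S N / ε) (hS : Tendsto S atTop (𝓝 0)) :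
    Tendsto a atTop (𝓝 0) := by
  rw [Metric.tendsto_atTop]
  intro ε hε
  have h2 : Tendsto (fun N => S N / (ε / 2)) atTop (𝓝 (0 / (ε / 2))) := hS.div_const _
  rw [zero_div] at h2
  obtain ⟨N₀, hN₀⟩ := eventually_atTop.1 (h2.eventually_lt_const (half_pos hε))
  refine ⟨N₀, fun N hN => ?_⟩
  rw [Real.dist_0_eq_abs, abs_of_nonneg (h0 N)]
  linarith [h (ε / 2) (half_pos hε) N, hN₀ N hN]

theorem abs_le_add_sq_div {ε : ℝ} (hε : 0 < ε) (x : ℝ) : |x| ≤ ε + x ^ 2 / ε := by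
  rw [← sub_le_iff_le_add', le_div_iff₀ hε, ← sq_abs x]
  nlinarith [sq_nonneg (|x| - ε), abs_nonneg x]

theorem tendsto_integral_abs_of_sq {Ω : Type u} {mΩ : MeasurableSpace Ω} {P : Measure Ω}
    [IsProbabilityMeasure P] {F : ℕ → Ω → ℝ} (hF : ∀ N, Integrable (F N) P)
    (hF2 : ∀ N, Integrable (fun ω => F N ω ^ 2) P)
    (h : Tendsto (fun N => ∫ ω, F N ω ^ 2 ∂P) atTop (𝓝 0)) :
    Tendsto (fun N => ∫ ω, |F N ω| ∂P) atTop (𝓝 0) := by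
  refine tendsto_zero_of_le_add_div (fun N => integral_nonneg fun ω => abs_nonneg _) ?_ h
  intro ε hε N
  calc _ ≤ ∫ ω, (ε + F N ω ^ 2 / ε) ∂P :=
        integral_mono (hF N).abs ((integrable_const _).add ((hF2 N).div_const _))
          fun ω => abs_le_add_sq_div hε _
    _ = _ := by
        rw [integral_add (integrable_const _) ((hF2 N).div_const _), integral_div]
        simp

theorem sum_comp_le_of_injOn {d : ℕ → ℝ} (hd : ∀ m, 0 ≤ d m) {s t : Finset ℕ} {e : ℕ → ℕ}
    (he : Set.InjOn e s) (hst : ∀ k ∈ s, e k ∈ t) : ∑ k ∈ s, d (e k) ≤ ∑ m ∈ t, d m := by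
  rw [← Finset.sum_image (f := d) he]
  exact Finset.sum_le_sum_of_subset_of_nonneg
    (Finset.image_subset_iff.2 hst) fun m _ _ => hd m

/-- A double sum over time pairs is controlled by a single sum over time differences. -/
theorem sum_sum_le_of_eq_diff {D : ℕ → ℕ → ℝ} {d : ℕ → ℝ} (hd : ∀ m, 0 ≤ d m)
    (h1 : ∀ j m, D j (j + m) = d m) (hs : ∀ j k, D j k = D k j) (N : ℕ) :
    ∑ j ∈ Finset.Icc 1 N, ∑ k ∈ Finset.Icc 1 N, D j k ≤
      N * (2 * (d 0 + ∑ m ∈ Finset.Icc 1 N, d m)) := by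
  have h0 : d 0 + ∑ m ∈ Finset.Icc 1 N, d m = ∑ m ∈ Finset.range (N + 1), d m := by
    clear hs h1
    induction N with
    | zero => simp
    | succ n ih =>
      rw [Finset.sum_Icc_succ_top (by omega), Finset.sum_range_succ, ← ih, add_assoc]
  rw [h0]
  have key : ∀ j ∈ Finset.Icc 1 N, ∑ k ∈ Finset.Icc 1 N, D j k ≤
      2 * ∑ m ∈ Finset.range (N + 1), d m := by
    intro j hj
    -- Each row is cut at the diagonal; on either half the time difference is an injective function
    -- of `k`, so each half is at most one full sum of `d`.
    rw [← Finset.sum_filter_add_sum_filter_not _ (fun k => j ≤ k), two_mul]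
    refine add_le_add ?_ ?_
    · refine le_trans (le_of_eq ?_) (sum_comp_le_of_injOn hd (e := fun k => k - j)
        (s := (Finset.Icc 1 N).filter (fun k => j ≤ k)) ?_ ?_)
      · refine Finset.sum_congr rfl fun k hk => ?_
        rw [← h1 j, Nat.add_sub_cancel' (Finset.mem_filter.1 hk).2]
      · intro a ha b hb hab
        simp at ha hb hab
        omega
      · intro k hk
        simp at hk ⊢
        omega
    · refine le_trans (le_of_eq ?_) (sum_comp_le_of_injOn hd (e := fun k => j - k)
        (s := (Finset.Icc 1 N).filter (fun k => ¬ j ≤ k)) ?_ ?_)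
      · refine Finset.sum_congr rfl fun k hk => ?_
        rw [← h1 k, Nat.add_sub_cancel' (not_le.1 (Finset.mem_filter.1 hk).2).le, hs]
      · intro a ha b hb hab
        simp at ha hb hab
        omega
      · intro k hk
        simp at hj hk ⊢
        omega
  refine (Finset.sum_le_sum key).trans ?_
  simp

theorem tendsto_average_double_of_tendsto_average {D : ℕ → ℕ → ℝ} {d : ℕ → ℝ}
    (hd : ∀ m, 0 ≤ d m) (h1 : ∀ j m, D j (j + m) = d m) (hs : ∀ j k, D j k = D k j)
    (h : Tendsto (fun N : ℕ => (1 / (N : ℝ)) * ∑ m ∈ Finset.Icc 1 N, d m) atTop (𝓝 0)) :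
    Tendsto (fun N : ℕ => (1 / (N : ℝ)) ^ 2 *
      ∑ j ∈ Finset.Icc 1 N, ∑ k ∈ Finset.Icc 1 N, D j k) atTop (𝓝 0) := by
  have hD : ∀ j k, 0 ≤ D j k := by
    intro j k
    rcases le_total j k with hjk | hjk <;> obtain ⟨m, rfl⟩ := Nat.exists_eq_add_of_le hjk
    · rw [h1]; exact hd m
    · rw [hs, h1]; exact hd m
  have hlim : Tendsto (fun N : ℕ => 2 * (d 0 * (1 / (N : ℝ)) +
      (1 / (N : ℝ)) * ∑ m ∈ Finset.Icc 1 N, d m)) atTop (𝓝 (2 * (d 0 * 0 + 0))) :=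
    ((tendsto_one_div_atTop_nhds_zero_nat.const_mul (d 0)).add h).const_mul 2
  simp only [mul_zero, add_zero] at hlim
  refine squeeze_zero (fun N => mul_nonneg (by positivity)
    (Finset.sum_nonneg fun j _ => Finset.sum_nonneg fun k _ => hD j k)) (fun N => ?_) hlim
  calc _ ≤ (1 / (N : ℝ)) ^ 2 * (N * (2 * (d 0 + ∑ m ∈ Finset.Icc 1 N, d m))) :=
        mul_le_mul_of_nonneg_left (sum_sum_le_of_eq_diff hd h1 hs N) (by positivity)
    _ = _ := by
        rcases Nat.eq_zero_or_pos N with rfl | hN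
        · simp
        · have : (N : ℝ) ≠ 0 := by positivity
          field_simp

/-! ### Conditional covariances as conditional expectations of centered indicators. -/

/-- A version of the conditional probability of `A` with values in `[0, 1]`. -/
theorem exists_condProb_version {Ω : Type u} {𝒴 mΩ : MeasurableSpace Ω} (P : Measure Ω)
    [IsFiniteMeasure P] (h𝒴 : 𝒴 ≤ mΩ) {A : Set Ω} (hA : MeasurableSet[mΩ] A) :
    ∃ g : Ω → ℝ, Measurable[𝒴] g ∧ (∀ ω, 0 ≤ g ω ∧ g ω ≤ 1) ∧ g =ᵐ[P] P⟦A|𝒴⟧ := by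
  have hi : Integrable (A.indicator fun _ => (1 : ℝ)) P := (integrable_const _).indicator hA
  refine ⟨fun ω => max 0 (min 1 ((P⟦A|𝒴⟧) ω)), ?_, fun ω => ⟨le_max_left _ _, ?_⟩, ?_⟩
  · exact measurable_const.max (measurable_const.min stronglyMeasurable_condExp.measurable)
  · exact max_le zero_le_one (min_le_left _ _)
  · have h0 : 0 ≤ᵐ[P] P⟦A|𝒴⟧ := condExp_nonneg
      (Eventually.of_forall fun ω => Set.indicator_nonneg (fun _ _ => zero_le_one) ω)
    have h1 : P⟦A|𝒴⟧ ≤ᵐ[P] P[fun _ => (1 : ℝ)|𝒴] := condExp_mono hi (integrable_const _)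
      (Eventually.of_forall fun ω => Set.indicator_le_self' (fun _ _ => zero_le_one) ω)
    rw [condExp_const h𝒴] at h1
    filter_upwards [h0, h1] with ω h0 h1
    rw [min_eq_right h1, max_eq_right (show (0 : ℝ) ≤ _ from h0)]

/-- Conditional covariance formula. -/
theorem condExp_centered_mul {Ω : Type u} {𝒴 mΩ : MeasurableSpace Ω} {P : Measure Ω}
    [IsFiniteMeasure P] (h𝒴 : 𝒴 ≤ mΩ) {X Y p q : Ω → ℝ}
    (hX : Measurable[mΩ] X) (hX1 : ∀ ω, |X ω| ≤ 1) (hY : Measurable[mΩ] Y) (hY1 : ∀ ω, |Y ω| ≤ 1)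
    (hp : Measurable[𝒴] p) (hp1 : ∀ ω, |p ω| ≤ 1) (hq : Measurable[𝒴] q) (hq1 : ∀ ω, |q ω| ≤ 1)
    (hpX : p =ᵐ[P] P[X|𝒴]) (hqY : q =ᵐ[P] P[Y|𝒴]) :
    P[fun ω => (X ω - p ω) * (Y ω - q ω)|𝒴] =ᵐ[P]
      fun ω => (P[fun ω => X ω * Y ω|𝒴]) ω - p ω * q ω := by
  have hp' := hp.mono h𝒴 le_rfl
  have hq' := hq.mono h𝒴 le_rfl
  have iX := integrable_of_abs_le (P := P) hX hX1
  have iY := integrable_of_abs_le (P := P) hY hY1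
  have iXY : Integrable (X * Y) P :=
    integrable_of_abs_le (hX.mul hY) fun ω => abs_mul_le_one (hX1 ω) (hY1 ω)
  have ipY : Integrable (p * Y) P :=
    integrable_of_abs_le (hp'.mul hY) fun ω => abs_mul_le_one (hp1 ω) (hY1 ω)
  have iqX : Integrable (q * X) P :=
    integrable_of_abs_le (hq'.mul hX) fun ω => abs_mul_le_one (hq1 ω) (hX1 ω)
  have ipq : Integrable (p * q) P :=
    integrable_of_abs_le (hp'.mul hq') fun ω => abs_mul_le_one (hp1 ω) (hq1 ω)
  have e : (fun ω => (X ω - p ω) * (Y ω - q ω)) = ((X * Y - p * Y) - q * X) + p * q := by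
    ext ω; simp only [Pi.add_apply, Pi.sub_apply, Pi.mul_apply]; ring
  rw [e]
  have e1 := condExp_add ((iXY.sub ipY).sub iqX) ipq 𝒴
  have e2 := condExp_sub (iXY.sub ipY) iqX 𝒴
  have e3 := condExp_sub iXY ipY 𝒴
  have e4 := condExp_mul_of_stronglyMeasurable_left hp.stronglyMeasurable ipY iY
  have e5 := condExp_mul_of_stronglyMeasurable_left hq.stronglyMeasurable iqX iX
  have e6 : P[p * q|𝒴] = p * q :=
    condExp_of_stronglyMeasurable h𝒴 (hp.mul hq).stronglyMeasurable ipq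
  filter_upwards [e1, e2, e3, e4, e5, hpX, hqY] with ω h1 h2 h3 h4 h5 h6 h7
  have e7 : (P[X * Y|𝒴]) ω = (P[fun ω => X ω * Y ω|𝒴]) ω := rfl
  rw [h1, Pi.add_apply, h2, Pi.sub_apply, h3, Pi.sub_apply, h4, h5, e6]
  simp only [Pi.mul_apply]
  rw [← h6, ← h7, e7]
  ring

theorem indicator_image_iterate {Ω : Type u} {mΩ : MeasurableSpace Ω} (T : Ω ≃ᵐ Ω) (B : Set Ω)
    (k : ℕ) : (T^[k] '' B).indicator (fun _ => (1 : ℝ)) =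
      (B.indicator fun _ => (1 : ℝ)) ∘ T.symm^[k] := by
  have h1 : Function.LeftInverse T.symm^[k] T^[k] :=
    Function.LeftInverse.iterate T.symm_apply_apply k
  have h2 : Function.RightInverse T.symm^[k] T^[k] :=
    Function.LeftInverse.iterate T.apply_symm_apply k
  rw [Set.image_eq_preimage_of_inverse h1 h2]
  rfl

theorem abs_indicator_one_le {Ω : Type u} (A : Set Ω) (ω : Ω) :
    |A.indicator (fun _ => (1 : ℝ)) ω| ≤ 1 := by
  by_cases h : ω ∈ A <;> simp [h]

theorem abs_indicator_sub_le {Ω : Type u} (A : Set Ω) {g : Ω → ℝ}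
    (hg : ∀ ω, 0 ≤ g ω ∧ g ω ≤ 1) (ω : Ω) : |A.indicator (fun _ => (1 : ℝ)) ω - g ω| ≤ 1 := by
  have := hg ω
  by_cases h : ω ∈ A <;> simp [h, abs_le] <;> constructor <;> linarith

/-- The conditional covariance of `A` and `TᵏB` in terms of centered indicators. -/
theorem condExp_inter_image_iterate_sub {Ω : Type u} {𝒴 mΩ : MeasurableSpace Ω} {P : Measure Ω}
    [IsFiniteMeasure P] (h𝒴 : 𝒴 ≤ mΩ) {T : Ω ≃ᵐ Ω} (hT : MeasurePreserving T P P)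
    (h : 𝒴.comap T = 𝒴) {A B : Set Ω} (hA : MeasurableSet[mΩ] A) (hB : MeasurableSet[mΩ] B)
    {gA gB : Ω → ℝ} (hgA : Measurable[𝒴] gA) (hgA1 : ∀ ω, 0 ≤ gA ω ∧ gA ω ≤ 1)
    (hgAe : gA =ᵐ[P] P⟦A|𝒴⟧) (hgB : Measurable[𝒴] gB) (hgB1 : ∀ ω, 0 ≤ gB ω ∧ gB ω ≤ 1)
    (hgBe : gB =ᵐ[P] P⟦B|𝒴⟧) (k : ℕ) :
    (fun ω => (P⟦A ∩ T^[k] '' B|𝒴⟧) ω - (P⟦A|𝒴⟧) ω * (P⟦T^[k] '' B|𝒴⟧) ω) =ᵐ[P]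
      P[fun ω => (A.indicator (fun _ => (1 : ℝ)) ω - gA ω) *
        (B.indicator (fun _ => (1 : ℝ)) (T.symm^[k] ω) - gB (T.symm^[k] ω))|𝒴] := by
  have hS : MeasurePreserving T.symm^[k] P P := (hT.symm T).iterate k
  have hS𝒴 : 𝒴.comap T.symm^[k] = 𝒴 := comap_iterate_eq (comap_symm_eq_of_comap_eq h) k
  have hB' : Measurable[mΩ] (B.indicator fun _ => (1 : ℝ)) := measurable_const.indicator hB
  have hBi : Integrable (B.indicator fun _ => (1 : ℝ)) P := (integrable_const _).indicator hB
  have hBk : gB ∘ T.symm^[k] =ᵐ[P] P⟦T^[k] '' B|𝒴⟧ := by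
    rw [indicator_image_iterate]
    refine EventuallyEq.trans ?_ (condExp_comp_of_comap_eq h𝒴 hS hS𝒴 hBi).symm
    exact hS.quasiMeasurePreserving.ae_eq_comp hgBe
  have abs1 : ∀ {g : Ω → ℝ}, (∀ ω, 0 ≤ g ω ∧ g ω ≤ 1) → ∀ ω, |g ω| ≤ 1 := fun hg ω =>
    abs_le.2 ⟨by linarith [(hg ω).1], (hg ω).2⟩
  have key := condExp_centered_mul (P := P) h𝒴 (X := A.indicator fun _ => (1 : ℝ))
    (Y := (B.indicator fun _ => (1 : ℝ)) ∘ T.symm^[k]) (p := gA) (q := gB ∘ T.symm^[k])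
    (measurable_const.indicator hA) (abs_indicator_one_le A)
    (hB'.comp hS.measurable) (fun ω => abs_indicator_one_le B _) hgA (abs1 hgA1)
    (hgB.comp (measurable_iff_comap_le.2 hS𝒴.le)) (fun ω => abs1 hgB1 _) hgAe
    (by rw [← indicator_image_iterate]; exact hBk)
  have e : (fun ω => A.indicator (fun _ => (1 : ℝ)) ω *
      ((B.indicator fun _ => (1 : ℝ)) ∘ T.symm^[k]) ω) =
      (A ∩ T^[k] '' B).indicator (fun _ => (1 : ℝ)) := by
    rw [← indicator_image_iterate]
    ext ω
    by_cases h1 : ω ∈ A <;> by_cases h2 : ω ∈ T^[k] '' B <;>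
      simp only [Set.indicator, Set.mem_inter_iff, h1, h2, if_true, if_false, and_true, and_false,
        mul_one, mul_zero]
  rw [e] at key
  filter_upwards [key, hgAe, hBk] with ω h1 h2 h3
  refine Eq.trans ?_ h1.symm
  rw [← h2, ← h3]

theorem abs_average_le {x : ℕ → ℝ} {C : ℝ} (hC : 0 ≤ C) (hx : ∀ k, |x k| ≤ C) (N : ℕ) :
    |(1 / (N : ℝ)) * ∑ k ∈ Finset.Icc 1 N, x k| ≤ C := by
  rw [abs_mul, abs_of_nonneg (by positivity : (0 : ℝ) ≤ 1 / (N : ℝ))]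
  calc _ ≤ (1 / (N : ℝ)) * ∑ k ∈ Finset.Icc 1 N, C :=
        mul_le_mul_of_nonneg_left ((Finset.abs_sum_le_sum_abs _ _).trans
          (Finset.sum_le_sum fun k _ => hx k)) (by positivity)
    _ ≤ C := by
        rw [Finset.sum_const, Nat.card_Icc, Nat.add_sub_cancel, nsmul_eq_mul, ← mul_assoc]
        refine mul_le_of_le_one_left hC ?_
        rcases Nat.eq_zero_or_pos N with rfl | hN
        · simp
        · rw [one_div_mul_cancel (by positivity)]

theorem eLpNorm_one_eq_ofReal_integral {Ω : Type u} {mΩ : MeasurableSpace Ω} {P : Measure Ω}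
    {F : Ω → ℝ} (hF : Integrable F P) (h0 : ∀ ω, 0 ≤ F ω) :
    eLpNorm F 1 P = ENNReal.ofReal (∫ ω, F ω ∂P) := by
  rw [eLpNorm_one_eq_lintegral_enorm, ← ofReal_integral_norm_eq_lintegral_enorm hF]
  simp only [Real.norm_of_nonneg (h0 _)]

/-- The `L¹` norm occurring in the definition of conditional weak mixing, in terms of centered
indicators. -/
theorem eLpNorm_average_condCov_eq {Ω : Type u} {𝒴 mΩ : MeasurableSpace Ω} {P : Measure Ω}
    [IsFiniteMeasure P] (h𝒴 : 𝒴 ≤ mΩ) {T : Ω ≃ᵐ Ω} (hT : MeasurePreserving T P P)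
    (h : 𝒴.comap T = 𝒴) {A B : Set Ω} (hA : MeasurableSet[mΩ] A) (hB : MeasurableSet[mΩ] B)
    {gA gB : Ω → ℝ} (hgA : Measurable[𝒴] gA) (hgA1 : ∀ ω, 0 ≤ gA ω ∧ gA ω ≤ 1)
    (hgAe : gA =ᵐ[P] P⟦A|𝒴⟧) (hgB : Measurable[𝒴] gB) (hgB1 : ∀ ω, 0 ≤ gB ω ∧ gB ω ≤ 1)
    (hgBe : gB =ᵐ[P] P⟦B|𝒴⟧) (N : ℕ) :
    eLpNorm (fun ω => (1 / (N : ℝ)) * ∑ k ∈ Finset.Icc 1 N,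
        |(P⟦A ∩ T^[k] '' B|𝒴⟧) ω - (P⟦A|𝒴⟧) ω * (P⟦T^[k] '' B|𝒴⟧) ω|) 1 P =
      ENNReal.ofReal ((1 / (N : ℝ)) * ∑ k ∈ Finset.Icc 1 N,
        ∫ ω, |(P[fun ω => (A.indicator (fun _ => (1 : ℝ)) ω - gA ω) *
          (B.indicator (fun _ => (1 : ℝ)) (T.symm^[k] ω) - gB (T.symm^[k] ω))|𝒴]) ω| ∂P) := by
  have e : (fun ω => (1 / (N : ℝ)) * ∑ k ∈ Finset.Icc 1 N,
        |(P⟦A ∩ T^[k] '' B|𝒴⟧) ω - (P⟦A|𝒴⟧) ω * (P⟦T^[k] '' B|𝒴⟧) ω|) =ᵐ[P]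
      fun ω => (1 / (N : ℝ)) * ∑ k ∈ Finset.Icc 1 N,
        |(P[fun ω => (A.indicator (fun _ => (1 : ℝ)) ω - gA ω) *
          (B.indicator (fun _ => (1 : ℝ)) (T.symm^[k] ω) - gB (T.symm^[k] ω))|𝒴]) ω| := by
    have := ae_all_iff.2 fun k => condExp_inter_image_iterate_sub h𝒴 hT h hA hB hgA hgA1 hgAe
      hgB hgB1 hgBe k
    filter_upwards [this] with ω hω
    congr 1
    exact Finset.sum_congr rfl fun k _ => by rw [hω k]
  have hi : ∀ k ∈ Finset.Icc 1 N, Integrable (fun ω =>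
      |(P[fun ω => (A.indicator (fun _ => (1 : ℝ)) ω - gA ω) *
        (B.indicator (fun _ => (1 : ℝ)) (T.symm^[k] ω) - gB (T.symm^[k] ω))|𝒴]) ω|) P :=
    fun k _ => integrable_condExp.abs
  rw [eLpNorm_congr_ae e, eLpNorm_one_eq_ofReal_integral ((integrable_finsetSum _ hi).const_mul _)
    (fun ω => by positivity), integral_const_mul, integral_finsetSum _ hi]

/-! ### Conditional weak mixing makes weighted averages vanish. -/

/-- The Cesàro averages of `f ∘ Tᵏ - P[f|𝒴] ∘ Tᵏ` vanish in `L¹`, for all bounded weights that are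
measurable with respect to `𝒴`. -/
def HasVanishingWeightedAverages {Ω : Type u} (𝒴 : MeasurableSpace Ω) {mΩ : MeasurableSpace Ω}
    (T : Ω → Ω) (P : Measure Ω) (f : Ω → ℝ) : Prop :=
  ∀ w : ℕ → Ω → ℝ, (∀ k, Measurable[𝒴] (w k)) → (∀ k ω, |w k ω| ≤ 1) →
    Tendsto (fun N : ℕ => ∫ ω, |(1 / (N : ℝ)) * ∑ k ∈ Finset.Icc 1 N,
      w k ω * (f (T^[k] ω) - (P[f|𝒴]) (T^[k] ω))| ∂P) atTop (𝓝 0)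

theorem ae_forall_iterate {Ω : Type u} {mΩ : MeasurableSpace Ω} {P : Measure Ω} {T : Ω → Ω}
    (hT : MeasurePreserving T P P) {p : Ω → Prop} (h : ∀ᵐ ω ∂P, p ω) :
    ∀ᵐ ω ∂P, ∀ k, p (T^[k] ω) :=
  ae_all_iff.2 fun k => (hT.iterate k).quasiMeasurePreserving.ae h

theorem integral_abs_average_le {Ω : Type u} {mΩ : MeasurableSpace Ω} {P : Measure Ω}
    {w b : ℕ → Ω → ℝ} (hw1 : ∀ k ω, |w k ω| ≤ 1) (hb : ∀ k, Integrable (b k) P) {C : ℝ}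
    (hC : ∀ k, ∫ ω, |b k ω| ∂P ≤ C) (hC0 : 0 ≤ C) (N : ℕ) :
    ∫ ω, |(1 / (N : ℝ)) * ∑ k ∈ Finset.Icc 1 N, w k ω * b k ω| ∂P ≤ C := by
  calc _ ≤ ∫ ω, (1 / (N : ℝ)) * ∑ k ∈ Finset.Icc 1 N, |b k ω| ∂P := by
        refine integral_mono_of_nonneg (Eventually.of_forall fun ω => abs_nonneg _)
          ((integrable_finsetSum _ fun k _ => (hb k).abs).const_mul _)
          (Eventually.of_forall fun ω => ?_)
        simp only
        rw [abs_mul, abs_of_nonneg (by positivity : (0 : ℝ) ≤ 1 / (N : ℝ))]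
        refine mul_le_mul_of_nonneg_left ((Finset.abs_sum_le_sum_abs _ _).trans
          (Finset.sum_le_sum fun k _ => ?_)) (by positivity)
        rw [abs_mul]
        exact mul_le_of_le_one_left (abs_nonneg _) (hw1 k ω)
    _ = (1 / (N : ℝ)) * ∑ k ∈ Finset.Icc 1 N, ∫ ω, |b k ω| ∂P := by
        rw [integral_const_mul, integral_finsetSum _ fun k _ => (hb k).abs]
    _ ≤ C := (le_abs_self _).trans (abs_average_le hC0 (fun k => by
        rw [abs_of_nonneg (integral_nonneg fun ω => abs_nonneg _)]; exact hC k) N)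

theorem integrable_average {Ω : Type u} {𝒴 mΩ : MeasurableSpace Ω} {P : Measure Ω}
    (h𝒴 : 𝒴 ≤ mΩ) {w b : ℕ → Ω → ℝ} (hw : ∀ k, Measurable[𝒴] (w k)) (hw1 : ∀ k ω, |w k ω| ≤ 1)
    (hb : ∀ k, Integrable (b k) P) (N : ℕ) :
    Integrable (fun ω => (1 / (N : ℝ)) * ∑ k ∈ Finset.Icc 1 N, w k ω * b k ω) P :=
  (integrable_finsetSum _ fun k _ => (hb k).bdd_mul
    ((hw k).mono h𝒴 le_rfl).aestronglyMeasurable (Eventually.of_forall (hw1 k))).const_mul _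

theorem integrable_sub_condExp_iterate {Ω : Type u} {𝒴 mΩ : MeasurableSpace Ω} {P : Measure Ω}
    {T : Ω → Ω} (hT : MeasurePreserving T P P) {f : Ω → ℝ}
    (hf : Integrable f P) (k : ℕ) :
    Integrable (fun ω => f (T^[k] ω) - (P[f|𝒴]) (T^[k] ω)) P :=
  (hT.iterate k).integrable_comp_of_integrable (hf.sub integrable_condExp)

theorem integral_abs_sub_condExp_iterate_le {Ω : Type u} {𝒴 mΩ : MeasurableSpace Ω}
    {P : Measure Ω} {T : Ω → Ω} (hT : MeasurePreserving T P P)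
    {f : Ω → ℝ} (hf : Integrable f P) (k : ℕ) :
    ∫ ω, |f (T^[k] ω) - (P[f|𝒴]) (T^[k] ω)| ∂P ≤ 2 * ∫ ω, |f ω| ∂P := by
  have hi : Integrable (fun ω => |f ω - (P[f|𝒴]) ω|) P := (hf.sub integrable_condExp).abs
  have h1 : ∫ ω, |f (T^[k] ω) - (P[f|𝒴]) (T^[k] ω)| ∂P = ∫ ω, |f ω - (P[f|𝒴]) ω| ∂P := by
    have := integral_map (μ := P) (hT.iterate k).measurable.aemeasurable
      (f := fun ω => |f ω - (P[f|𝒴]) ω|) (by rw [(hT.iterate k).map_eq]; exact hi.1)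
    rw [← this, (hT.iterate k).map_eq]
  rw [h1]
  calc _ ≤ ∫ ω, (|f ω| + |(P[f|𝒴]) ω|) ∂P :=
        integral_mono hi (hf.abs.add integrable_condExp.abs) fun ω => abs_sub _ _
    _ ≤ _ := by
        rw [integral_add hf.abs integrable_condExp.abs, two_mul]
        exact add_le_add le_rfl (integral_abs_condExp_le f)

theorem HasVanishingWeightedAverages.add {Ω : Type u} {𝒴 mΩ : MeasurableSpace Ω} {P : Measure Ω}
    (h𝒴 : 𝒴 ≤ mΩ) {T : Ω → Ω} (hT : MeasurePreserving T P P) {f g : Ω → ℝ}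
    (hf : Integrable f P) (hg : Integrable g P)
    (h1 : HasVanishingWeightedAverages 𝒴 T P f) (h2 : HasVanishingWeightedAverages 𝒴 T P g) :
    HasVanishingWeightedAverages 𝒴 T P (f + g) := by
  intro w hw hw1
  have hlim := (h1 w hw hw1).add (h2 w hw hw1)
  rw [add_zero] at hlim
  refine squeeze_zero (fun N => integral_nonneg fun ω => abs_nonneg _) (fun N => ?_) hlim
  have i1 := integrable_average h𝒴 hw hw1
    (integrable_sub_condExp_iterate (𝒴 := 𝒴) hT hf) N
  have i2 := integrable_average h𝒴 hw hw1
    (integrable_sub_condExp_iterate (𝒴 := 𝒴) hT hg) N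
  rw [← integral_add i1.abs i2.abs]
  refine integral_mono_of_nonneg (Eventually.of_forall fun ω => abs_nonneg _)
    (i1.abs.add i2.abs) ?_
  filter_upwards [ae_forall_iterate hT (condExp_add hf hg 𝒴)] with ω hω
  refine le_trans (le_of_eq ?_) (abs_add_le _ _)
  rw [← mul_add, ← Finset.sum_add_distrib]
  congr 2
  refine Finset.sum_congr rfl fun k _ => ?_
  rw [hω k]
  simp only [Pi.add_apply]
  ring

theorem HasVanishingWeightedAverages.const_mul {Ω : Type u} {𝒴 mΩ : MeasurableSpace Ω}
    {P : Measure Ω} {T : Ω → Ω} (hT : MeasurePreserving T P P) {f : Ω → ℝ} (c : ℝ)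
    (h1 : HasVanishingWeightedAverages 𝒴 T P f) :
    HasVanishingWeightedAverages 𝒴 T P (c • f) := by
  intro w hw hw1
  have hlim := (h1 w hw hw1).const_mul |c|
  rw [mul_zero] at hlim
  refine hlim.congr fun N => ?_
  rw [← integral_const_mul]
  refine integral_congr_ae ?_
  filter_upwards [ae_forall_iterate hT (condExp_smul c f 𝒴 (μ := P))] with ω hω
  rw [← abs_mul, mul_left_comm, Finset.mul_sum]
  congr 2
  refine Finset.sum_congr rfl fun k _ => ?_
  rw [hω k]
  simp only [Pi.smul_apply, smul_eq_mul]
  ring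

theorem IsCondWeakMixing.hasVanishingWeightedAverages_indicator {Ω : Type u}
    {𝒴 mΩ : MeasurableSpace Ω} {P : Measure Ω} [IsProbabilityMeasure P] (h𝒴 : 𝒴 ≤ mΩ)
    {T : Ω ≃ᵐ Ω} (hT : MeasurePreserving T P P) (h : 𝒴.comap T = 𝒴)
    (hwm : IsCondWeakMixing 𝒴 T P) {A : Set Ω} (hA : MeasurableSet[mΩ] A) :
    HasVanishingWeightedAverages 𝒴 T P (A.indicator fun _ => (1 : ℝ)) := by
  obtain ⟨g, hg, hg1, hge⟩ := exists_condProb_version P h𝒴 hA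
  set f : Ω → ℝ := fun ω => A.indicator (fun _ => (1 : ℝ)) ω - g ω with hfdef
  have hf : Measurable[mΩ] f := (measurable_const.indicator hA).sub (hg.mono h𝒴 le_rfl)
  have hf1 : ∀ ω, |f ω| ≤ 1 := abs_indicator_sub_le A hg1
  -- Mixing of `A` with itself suffices: only autocovariances enter the second moment.
  have hwm' := hwm A A hA hA
  have hd : Tendsto (fun N : ℕ => (1 / (N : ℝ)) * ∑ m ∈ Finset.Icc 1 N,
      ∫ ω, |(P[fun ω => f ω * f (T.symm^[m] ω)|𝒴]) ω| ∂P) atTop (𝓝 0) := by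
    have h0 := (ENNReal.tendsto_toReal ENNReal.zero_ne_top).comp hwm'
    rw [ENNReal.toReal_zero] at h0
    refine h0.congr fun N => ?_
    simp only [Function.comp]
    rw [eLpNorm_average_condCov_eq h𝒴 hT h hA hA hg hg1 hge hg hg1 hge, ENNReal.toReal_ofReal]
    exact mul_nonneg (by positivity)
      (Finset.sum_nonneg fun k _ => integral_nonneg fun ω => abs_nonneg _)
  have hS := tendsto_average_double_of_tendsto_average
    (D := fun j k => ∫ ω, |(P[fun ω => f (T^[j] ω) * f (T^[k] ω)|𝒴]) ω| ∂P)
    (fun m => integral_nonneg fun ω => abs_nonneg _)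
    (integral_abs_condExp_iterate_mul_eq h𝒴 hT h hf hf1) (fun j k => by simp only [mul_comm]) hd
  intro w hw hw1
  have hfk : ∀ k, Measurable[mΩ] fun ω => f (T^[k] ω) := fun k =>
    hf.comp (T.measurable.iterate k)
  have hFm : ∀ N : ℕ, Measurable[mΩ]
      fun ω : Ω => (1 / (N : ℝ)) * ∑ k ∈ Finset.Icc 1 N, w k ω * f (T^[k] ω) := fun N =>
    (Finset.measurable_sum _ fun k _ => ((hw k).mono h𝒴 le_rfl).mul (hfk k)).const_mul _
  have hF1 : ∀ (N : ℕ) (ω : Ω), |(1 / (N : ℝ)) * ∑ k ∈ Finset.Icc 1 N, w k ω * f (T^[k] ω)| ≤ 1 :=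
    fun N ω => abs_average_le zero_le_one (fun k => abs_mul_le_one (hw1 k ω) (hf1 _)) N
  have hsq := squeeze_zero (fun N : ℕ => integral_nonneg (μ := P) fun ω => sq_nonneg
    ((1 / (N : ℝ)) * ∑ k ∈ Finset.Icc 1 N, w k ω * f (T^[k] ω))) (fun N => ?_) hS
  · refine (tendsto_integral_abs_of_sq (fun N => integrable_of_abs_le (hFm N) (hF1 N))
      (fun N => integrable_of_abs_le (C := 1) ((hFm N).pow_const 2) fun ω => ?_) hsq).congr
      fun N => ?_
    · rw [abs_pow]; exact pow_le_one₀ (abs_nonneg _) (hF1 N ω)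
    · refine integral_congr_ae ?_
      filter_upwards [ae_forall_iterate hT hge] with ω hω
      simp only [hfdef, hω]
  · simp only [mul_pow]
    rw [integral_const_mul]
    exact mul_le_mul_of_nonneg_left (integral_sq_sum_le h𝒴 hw hw1 hfk (fun k ω => hf1 _) _)
      (by positivity)

/-- The weighted averages of `f - g` have `L¹` norm at most twice that of `f - g`, uniformly in `N`
and in the weights, so the property is closed in `L¹`. -/
theorem HasVanishingWeightedAverages.of_dense {Ω : Type u} {𝒴 mΩ : MeasurableSpace Ω}
    {P : Measure Ω} (h𝒴 : 𝒴 ≤ mΩ) {T : Ω → Ω} (hT : MeasurePreserving T P P)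
    {f : Ω → ℝ} (hf : Integrable f P)
    (H : ∀ ε > 0, ∃ g : Ω → ℝ, Integrable g P ∧ ∫ ω, |f ω - g ω| ∂P ≤ ε ∧
      HasVanishingWeightedAverages 𝒴 T P g) :
    HasVanishingWeightedAverages 𝒴 T P f := by
  intro w hw hw1
  rw [Metric.tendsto_atTop]
  intro ε hε
  obtain ⟨g, hg, hfg, hgv⟩ := H (ε / 4) (by positivity)
  obtain ⟨N₀, hN₀⟩ := eventually_atTop.1 ((hgv w hw hw1).eventually_lt_const (half_pos hε))
  refine ⟨N₀, fun N hN => ?_⟩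
  rw [Real.dist_0_eq_abs, abs_of_nonneg (integral_nonneg fun ω => abs_nonneg _)]
  have hb := integrable_sub_condExp_iterate (𝒴 := 𝒴) hT (hf.sub hg)
  have i1 := integrable_average h𝒴 hw hw1 hb N
  have i2 := integrable_average h𝒴 hw hw1 (integrable_sub_condExp_iterate (𝒴 := 𝒴) hT hg) N
  have b1 := integral_abs_average_le hw1 hb
    (fun k => integral_abs_sub_condExp_iterate_le hT (hf.sub hg) k)
    (mul_nonneg zero_le_two (integral_nonneg fun ω => abs_nonneg _)) N
  have b2 : ∫ ω, |(f - g) ω| ∂P ≤ ε / 4 := hfg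
  have b3 := hN₀ N hN
  refine (integral_mono_of_nonneg (Eventually.of_forall fun ω => abs_nonneg _)
    (i1.abs.add i2.abs) ?_).trans_lt ?_
  · filter_upwards [ae_forall_iterate hT (condExp_sub hf hg 𝒴)] with ω hω
    refine le_trans (le_of_eq ?_) (abs_add_le _ _)
    rw [← mul_add, ← Finset.sum_add_distrib]
    congr 2
    refine Finset.sum_congr rfl fun k _ => ?_
    rw [hω k]
    simp only [Pi.sub_apply]
    ring
  · simp only [Pi.add_apply]
    rw [integral_add i1.abs i2.abs]
    linarith

theorem IsCondWeakMixing.hasVanishingWeightedAverages {Ω : Type u}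
    {𝒴 mΩ : MeasurableSpace Ω} {P : Measure Ω} [IsProbabilityMeasure P] (h𝒴 : 𝒴 ≤ mΩ)
    {T : Ω ≃ᵐ Ω} (hT : MeasurePreserving T P P) (h : 𝒴.comap T = 𝒴)
    (hwm : IsCondWeakMixing 𝒴 T P) {f : Ω → ℝ} (hf : Integrable f P) :
    HasVanishingWeightedAverages 𝒴 T P f := by
  have hsimple : ∀ φ : @SimpleFunc Ω mΩ ℝ, HasVanishingWeightedAverages 𝒴 T P φ := by
    intro φ
    induction φ using SimpleFunc.induction with
    | @const c s hs =>
      have := (hwm.hasVanishingWeightedAverages_indicator h𝒴 hT h hs).const_mul hT c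
      convert this using 1
      ext ω
      by_cases hω : ω ∈ s <;> simp [hω]
    | @add φ ψ _ h1 h2 =>
      rw [SimpleFunc.coe_add]
      exact HasVanishingWeightedAverages.add h𝒴 hT φ.integrable_of_isFiniteMeasure
        ψ.integrable_of_isFiniteMeasure h1 h2
  refine HasVanishingWeightedAverages.of_dense h𝒴 hT hf fun ε hε => ?_
  obtain ⟨φ, hφ, hφi⟩ := (memLp_one_iff_integrable.2 hf).exists_simpleFunc_eLpNorm_sub_lt
    ENNReal.one_ne_top (ε := ENNReal.ofReal ε) (by simpa using hε)
  have hφi := memLp_one_iff_integrable.1 hφi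
  refine ⟨φ, hφi, ?_, hsimple φ⟩
  rw [eLpNorm_one_eq_lintegral_enorm,
    ← ofReal_integral_norm_eq_lintegral_enorm (hf.sub hφi)] at hφ
  exact ((ENNReal.ofReal_lt_ofReal_iff hε).1 hφ).le

/-! ### Minimizing the conditional expected loss is optimal. -/

/-- The minimizer is selected through an enumeration by `ℕ`, since every map out of `ℕ` is
measurable whatever the σ-field on `U`; singletons of `U` need not be measurable. -/
theorem exists_measurable_argmin {Ω : Type u} {U : Type v} {𝒴 : MeasurableSpace Ω}
    [MeasurableSpace U] [Finite U] [Nonempty U] {E : U → Ω → ℝ} (hE : ∀ a, Measurable[𝒴] (E a)) :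
    ∃ m : Ω → U, Measurable[𝒴] m ∧ ∀ ω a, E (m ω) ω ≤ E a ω := by
  classical
  obtain ⟨e, he⟩ := exists_surjective_nat U
  have hex : ∀ ω, ∃ n, ∀ a, E (e n) ω ≤ E a ω := fun ω => by
    obtain ⟨b, hb⟩ := Finite.exists_min fun a => E a ω
    obtain ⟨n, rfl⟩ := he b
    exact ⟨n, hb⟩
  refine ⟨fun ω => e (Nat.find (hex ω)), ?_, fun ω a => Nat.find_spec (hex ω) a⟩
  refine (measurable_from_nat (f := e)).comp (measurable_find hex fun n => ?_)
  have : {ω | ∀ a, E (e n) ω ≤ E a ω} = ⋂ a, {ω | E (e n) ω ≤ E a ω} := by ext; simp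
  rw [this]
  exact MeasurableSet.iInter fun a => measurableSet_le (hE _) (hE a)

/-- A choice of one representative in each atom of a countable measurable space. -/
theorem exists_measurableAtom_representative (U : Type v) [MeasurableSpace U] [Countable U] :
    ∃ r : U → U, (∀ a, r a ∈ measurableAtom a) ∧ ∀ b, MeasurableSet (r ⁻¹' {b}) := by
  classical
  have hne : ∀ a : U, ∃ b, b ∈ measurableAtom a := fun a => ⟨a, mem_measurableAtom_self a⟩
  let ρ : Set U → U → U := fun s a => if h : ∃ b, b ∈ s then h.choose else a
  have hρ : ∀ a, ρ (measurableAtom a) a ∈ measurableAtom a := fun a => by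
    simp only [ρ, dif_pos (hne a)]
    exact (hne a).choose_spec
  refine ⟨fun a => ρ (measurableAtom a) a, hρ, fun b => ?_⟩
  have hconst : ∀ {a c}, c ∈ measurableAtom a →
      ρ (measurableAtom c) c = ρ (measurableAtom a) a := fun {a c} hc => by
    rw [measurableAtom_eq_of_mem hc]
    simp only [ρ, dif_pos (hne a)]
  have : (fun a => ρ (measurableAtom a) a) ⁻¹' {b} =
      ⋃ a ∈ (fun a => ρ (measurableAtom a) a) ⁻¹' {b}, measurableAtom a := by
    ext c
    simp only [Set.mem_iUnion, Set.mem_preimage, Set.mem_singleton_iff, exists_prop]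
    exact ⟨fun hc => ⟨c, hc, mem_measurableAtom_self c⟩, fun ⟨a, ha, hc⟩ => (hconst hc).trans ha⟩
  rw [this]
  exact MeasurableSet.biUnion (Set.to_countable _)
    fun a _ => MeasurableSet.measurableAtom_of_countable a

/-- Level sets of `ℓ (·, ω)` are measurable and therefore unions of atoms, so decisions may be
replaced by representatives of their atoms. -/
theorem eq_of_mem_measurableAtom {Ω : Type u} {U : Type v} {mΩ : MeasurableSpace Ω}
    [mU : MeasurableSpace U] {ℓ : U × Ω → ℝ} (hℓ : Measurable[mU.prod mΩ] ℓ) {a b : U}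
    (hab : b ∈ measurableAtom a) (ω : Ω) : ℓ (b, ω) = ℓ (a, ω) :=
  mem_of_mem_measurableAtom hab
    ((hℓ.comp measurable_prodMk_right) (measurableSet_singleton (ℓ (a, ω)))) rfl

/-- With finitely many decisions, the sum splits according to the decision taken; for each fixed
decision the events of taking it supply `𝒴`-measurable weights. -/
theorem HasVanishingWeightedAverages.tendsto_averageLoss {Ω : Type u} {U : Type v}
    {𝒴 mΩ : MeasurableSpace Ω} {P : Measure Ω} [IsFiniteMeasure P] (h𝒴 : 𝒴 ≤ mΩ)
    {T : Ω → Ω} (hT : MeasurePreserving T P P)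
    (hv : ∀ f : Ω → ℝ, Integrable f P → HasVanishingWeightedAverages 𝒴 T P f)
    [mU : MeasurableSpace U] [Finite U] {ℓ : U × Ω → ℝ} (hℓ : Measurable[mU.prod mΩ] ℓ)
    {C : ℝ} (hC : ∀ a ω, |ℓ (a, ω)| ≤ C) {s : ℕ → Ω → U}
    (hs : ∀ k, 1 ≤ k → Measurable[𝒴] (s k)) :
    (∀ N : ℕ, Integrable (fun ω => (1 / (N : ℝ)) * ∑ k ∈ Finset.Icc 1 N,
      (ℓ (s k ω, T^[k] ω) - (P[fun ω' => ℓ (s k ω, ω')|𝒴]) (T^[k] ω))) P) ∧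
    Tendsto (fun N : ℕ => ∫ ω, |(1 / (N : ℝ)) * ∑ k ∈ Finset.Icc 1 N,
      (ℓ (s k ω, T^[k] ω) - (P[fun ω' => ℓ (s k ω, ω')|𝒴]) (T^[k] ω))| ∂P) atTop (𝓝 0) := by
  classical
  have := Fintype.ofFinite U
  obtain ⟨r, hr, hrm⟩ := exists_measurableAtom_representative U
  have hℓr : ∀ a, (fun ω => ℓ (a, ω)) = fun ω => ℓ (r a, ω) := fun a =>
    funext fun ω => (eq_of_mem_measurableAtom hℓ (hr a) ω).symm
  -- The weight at `k = 0` is set to zero because `s 0` need not be measurable; passing to `r (s k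
  -- ω)` makes the events measurable when `U` is not discrete.
  let w : U → ℕ → Ω → ℝ := fun a k ω => if 1 ≤ k ∧ r (s k ω) = a then 1 else 0
  have hw : ∀ a k, Measurable[𝒴] (w a k) := fun a k => by
    by_cases hk : 1 ≤ k
    · simp only [w, hk, true_and]
      exact Measurable.ite (hs k hk (hrm a)) measurable_const measurable_const
    · simp only [w, hk, false_and, if_false]
      exact measurable_const
  have hw1 : ∀ a k ω, |w a k ω| ≤ 1 := fun a k ω => by
    simp only [w]; split_ifs <;> simp
  have hint : ∀ a, Integrable (fun ω => ℓ (a, ω)) P := fun a =>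
    integrable_of_abs_le (hℓ.comp measurable_prodMk_left) (hC a)
  let R : U → ℕ → Ω → ℝ := fun a N ω => (1 / (N : ℝ)) * ∑ k ∈ Finset.Icc 1 N,
    w a k ω * (ℓ (a, T^[k] ω) - (P[fun ω' => ℓ (a, ω')|𝒴]) (T^[k] ω))
  have hR : ∀ a N, Integrable (R a N) P := fun a N =>
    integrable_average h𝒴 (hw a) (hw1 a) (integrable_sub_condExp_iterate hT (hint a)) N
  have key : ∀ (N : ℕ) (ω : Ω), (1 / (N : ℝ)) * ∑ k ∈ Finset.Icc 1 N,
      (ℓ (s k ω, T^[k] ω) - (P[fun ω' => ℓ (s k ω, ω')|𝒴]) (T^[k] ω)) = ∑ a, R a N ω := by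
    intro N ω
    simp only [R]
    rw [← Finset.mul_sum, Finset.sum_comm]
    congr 1
    refine Finset.sum_congr rfl fun k hk => ?_
    have hk : 1 ≤ k := (Finset.mem_Icc.1 hk).1
    rw [Finset.sum_eq_single (r (s k ω))]
    · simp only [w, hk, true_and, if_true, one_mul]
      rw [hℓr (s k ω), eq_of_mem_measurableAtom hℓ (hr (s k ω))]
    · intro b _ hb
      simp only [w, hb.symm, and_false, if_false, zero_mul]
    · simp
  simp only [key]
  refine ⟨fun N => integrable_finsetSum _ fun a _ => hR a N, ?_⟩
  have hlim := tendsto_finsetSum Finset.univ fun a (_ : a ∈ Finset.univ) =>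
    hv _ (hint a) (w a) (hw a) (hw1 a)
  rw [Finset.sum_const_zero] at hlim
  refine squeeze_zero (fun N => integral_nonneg fun ω => abs_nonneg _) (fun N => ?_) hlim
  rw [← integral_finsetSum _ fun a _ => (hR a N).abs]
  exact integral_mono (integrable_finsetSum _ fun a _ => hR a N).abs
    (integrable_finsetSum _ fun a _ => (hR a N).abs) fun ω => Finset.abs_sum_le_sum_abs _ _

/-- Markov's inequality. Subadditivity is used in place of the complement formula, so `G N` need not
be measurable. -/
theorem tendsto_measure_one_of_tendsto_integral {Ω : Type u} {mΩ : MeasurableSpace Ω}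
    {P : Measure Ω} [IsProbabilityMeasure P] {G : ℕ → Set Ω} {F : ℕ → Ω → ℝ}
    (hF : ∀ N, Integrable (F N) P) (h0 : ∀ N ω, 0 ≤ F N ω)
    (hlim : Tendsto (fun N => ∫ ω, F N ω ∂P) atTop (𝓝 0)) {ε : ℝ} (hε : 0 < ε)
    (hG : ∀ N ω, F N ω < ε → ω ∈ G N) : Tendsto (fun N => P (G N)) atTop (𝓝 1) := by
  have h1 : Tendsto (fun N => 1 - ENNReal.ofReal ((∫ ω, F N ω ∂P) / ε)) atTop (𝓝 1) := by
    have := ENNReal.tendsto_ofReal (hlim.div_const ε)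
    rw [zero_div, ENNReal.ofReal_zero] at this
    simpa using ENNReal.Tendsto.sub (tendsto_const_nhds (x := (1 : ENNReal))) this
      (Or.inl ENNReal.one_ne_top)
  refine tendsto_of_tendsto_of_tendsto_of_le_of_le h1 tendsto_const_nhds (fun N => ?_)
    fun N => prob_le_one
  have h2 : P (G N)ᶜ ≤ ENNReal.ofReal ((∫ ω, F N ω ∂P) / ε) := by
    have h3 := mul_meas_ge_le_integral_of_nonneg (Eventually.of_forall (h0 N)) (hF N) ε
    rw [mul_comm, ← le_div_iff₀ hε] at h3
    calc P (G N)ᶜ ≤ P {ω | ε ≤ F N ω} :=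
          measure_mono fun ω hω => not_lt.1 fun hlt => hω (hG N ω hlt)
      _ = ENNReal.ofReal (P.real {ω | ε ≤ F N ω}) := by rw [ofReal_measureReal]
      _ ≤ _ := ENNReal.ofReal_le_ofReal h3
  simp only
  rw [tsub_le_iff_right]
  calc (1 : ENNReal) = P (G N ∪ (G N)ᶜ) := by rw [Set.union_compl_self, measure_univ]
    _ ≤ P (G N) + P (G N)ᶜ := measure_union_le _ _
    _ ≤ _ := add_le_add le_rfl h2

/-- Under conditional weak mixing, minimizing the conditional expected loss is optimal. -/
theorem IsCondWeakMixing.everyFiniteLossHasOptimal {Ω : Type u}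
    {𝒴 mΩ : MeasurableSpace Ω} {P : Measure Ω} [IsProbabilityMeasure P] (h𝒴 : 𝒴 ≤ mΩ)
    {T : Ω ≃ᵐ Ω} (hT : MeasurePreserving T P P) (h : 𝒴.comap T = 𝒴)
    (hwm : IsCondWeakMixing 𝒴 T P) : EveryFiniteLossHasOptimal.{u, v} 𝒴 T P := by
  intro U mU _ _ ℓ hℓ ⟨C, hC⟩
  obtain ⟨m, hm, hmin⟩ := exists_measurable_argmin (𝒴 := 𝒴)
    (E := fun a : U => P[fun ω' => ℓ (a, ω')|𝒴]) fun a => stronglyMeasurable_condExp.measurable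
  have hadm : ∀ s : ℕ → Ω → U, IsAdmissible 𝒴 T s ↔ ∀ k, 1 ≤ k → Measurable[𝒴] (s k) := by
    intro s
    exact forall₂_congr fun k _ => by rw [observedField_eq_of_comap_eq h]
  have hm' : ∀ k, 1 ≤ k → Measurable[𝒴] fun ω => m (T^[k] ω) := fun k _ =>
    hm.comp (measurable_iterate_of_comap_eq h k)
  refine ⟨fun k ω => m (T^[k] ω), (hadm _).2 hm', fun s hs ε hε => ?_⟩
  have hv := fun f hf => hwm.hasVanishingWeightedAverages h𝒴 hT h (f := f) hf
  obtain ⟨i1, l1⟩ := HasVanishingWeightedAverages.tendsto_averageLoss h𝒴 hT hv hℓ hC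
    ((hadm s).1 hs)
  obtain ⟨i2, l2⟩ := HasVanishingWeightedAverages.tendsto_averageLoss h𝒴 hT hv hℓ hC hm'
  have hlim := l1.add l2
  rw [add_zero] at hlim
  refine tendsto_measure_one_of_tendsto_integral (fun N => (i1 N).abs.add (i2 N).abs)
    (fun N ω => add_nonneg (abs_nonneg _) (abs_nonneg _)) (hlim.congr fun N => ?_) hε ?_
  · exact (integral_add (i1 N).abs (i2 N).abs).symm
  · intro N ω hlt
    simp only [Pi.add_apply] at hlt
    have hsum : (1 / (N : ℝ)) * ∑ k ∈ Finset.Icc 1 N,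
        (P[fun ω' => ℓ (m (T^[k] ω), ω')|𝒴]) (T^[k] ω) ≤ (1 / (N : ℝ)) * ∑ k ∈ Finset.Icc 1 N,
        (P[fun ω' => ℓ (s k ω, ω')|𝒴]) (T^[k] ω) :=
      mul_le_mul_of_nonneg_left (Finset.sum_le_sum fun k _ => hmin _ _) (by positivity)
    -- Below, `x3` and `x4` are the losses of `s` and of the minimizer, `x2` and `x1` their
    -- conditional expected losses. From `x1 ≤ x2` and `|x3 - x2| + |x4 - x1| < ε` follows `x3 - x4
    -- ≥ -ε`.
    simp only [Finset.sum_sub_distrib, mul_sub] at hlt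
    simp only [averageLoss, Set.mem_ofPred_eq]
    generalize (1 / (N : ℝ)) * ∑ k ∈ Finset.Icc 1 N,
        (P[fun ω' => ℓ (m (T^[k] ω), ω')|𝒴]) (T^[k] ω) = x1 at *
    generalize (1 / (N : ℝ)) * ∑ k ∈ Finset.Icc 1 N,
        (P[fun ω' => ℓ (s k ω, ω')|𝒴]) (T^[k] ω) = x2 at *
    generalize (1 / (N : ℝ)) * ∑ k ∈ Finset.Icc 1 N, ℓ (s k ω, T^[k] ω) = x3 at *
    generalize (1 / (N : ℝ)) * ∑ k ∈ Finset.Icc 1 N, ℓ (m (T^[k] ω), T^[k] ω) = x4 at *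
    linarith [neg_abs_le (x3 - x2), le_abs_self (x4 - x1)]

/-! ### An optimal strategy for a centered loss forces every strategy average to vanish. -/

theorem integral_mul_comp_iterate_eq_zero {Ω : Type u} {𝒴 mΩ : MeasurableSpace Ω}
    {P : Measure Ω} [IsFiniteMeasure P] (h𝒴 : 𝒴 ≤ mΩ) {T : Ω → Ω} (hT : MeasurePreserving T P P)
    (h : 𝒴.comap T = 𝒴) {f : Ω → ℝ} (hf : Integrable f P) (hf0 : P[f|𝒴] =ᵐ[P] 0) {w : Ω → ℝ}
    {C : ℝ} (hw : Measurable[𝒴] w) (hC : ∀ ω, |w ω| ≤ C) (k : ℕ) :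
    ∫ ω, w ω * f (T^[k] ω) ∂P = 0 := by
  have hk : P[f ∘ T^[k]|𝒴] =ᵐ[P] 0 :=
    (condExp_comp_of_comap_eq h𝒴 (hT.iterate k) (comap_iterate_eq h k) hf).trans
      ((hT.iterate k).quasiMeasurePreserving.ae_eq_comp hf0)
  have := integral_mul_condExp h𝒴 hw hC ((hT.iterate k).integrable_comp_of_integrable hf)
  refine this.symm.trans ?_
  rw [integral_congr_ae (g := fun _ => (0 : ℝ)), integral_zero]
  filter_upwards [hk] with ω hω
  rw [hω, Pi.zero_apply, mul_zero]

/-- Centered bounded random variables that are asymptotically nonnegative in probability vanish in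
`L¹`. -/
theorem tendsto_integral_abs_of_asymptotically_nonneg {Ω : Type u} {mΩ : MeasurableSpace Ω}
    {P : Measure Ω} [IsProbabilityMeasure P] {D : ℕ → Ω → ℝ} (hD : ∀ N, Measurable (D N)) {C : ℝ}
    (hC : ∀ N ω, |D N ω| ≤ C) (h0 : ∀ N, ∫ ω, D N ω ∂P = 0)
    (hlim : ∀ ε : ℝ, 0 < ε → Tendsto (fun N => P {ω | D N ω ≥ -ε}) atTop (𝓝 1)) :
    Tendsto (fun N => ∫ ω, |D N ω| ∂P) atTop (𝓝 0) := by
  rw [Metric.tendsto_atTop]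
  intro ε hε
  have hD' := fun N => integrable_of_abs_le (P := P) (hD N) (hC N)
  have hms : ∀ N, MeasurableSet {ω | D N ω ≥ -(ε / 4)} := fun N =>
    measurableSet_le measurable_const (hD N)
  have h1 : Tendsto (fun N => C * (1 - P.real {ω | D N ω ≥ -(ε / 4)})) atTop
      (𝓝 (C * (1 - 1))) :=
    (((ENNReal.tendsto_toReal ENNReal.one_ne_top).comp (hlim (ε / 4) (by positivity))).const_sub
      1).const_mul C
  rw [sub_self, mul_zero] at h1
  obtain ⟨N₀, hN₀⟩ := eventually_atTop.1 (h1.eventually_lt_const (by positivity : 0 < ε / 4))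
  refine ⟨N₀, fun N hN => ?_⟩
  rw [Real.dist_0_eq_abs, abs_of_nonneg (integral_nonneg fun ω => abs_nonneg _)]
  set G : Set Ω := {ω | D N ω ≥ -(ε / 4)} with hG
  have hind : Integrable (Gᶜ.indicator fun _ => C) P :=
    (integrable_const C).indicator (hms N).compl
  have hi2 : Integrable (fun ω => 2 * (ε / 4 + Gᶜ.indicator (fun _ => C) ω)) P :=
    ((integrable_const _).add hind).const_mul 2
  -- The right side is `D N` plus twice a bound for its negative part, so the zero mean of `D N`
  -- leaves only that bound to integrate.
  have hpt : ∀ ω, |D N ω| ≤ D N ω + 2 * (ε / 4 + Gᶜ.indicator (fun _ => C) ω) := by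
    intro ω
    have hCω := hC N ω
    by_cases hω : ω ∈ G
    · have hω' : D N ω ≥ -(ε / 4) := hω
      rw [Set.indicator_of_notMem (by simpa using hω), abs_le]
      constructor <;> linarith
    · rw [Set.indicator_of_mem (by simpa using hω)]
      rw [abs_le] at hCω ⊢
      constructor <;> linarith
  calc ∫ ω, |D N ω| ∂P ≤ ∫ ω, (D N ω + 2 * (ε / 4 + Gᶜ.indicator (fun _ => C) ω)) ∂P :=
        integral_mono (hD' N).abs ((hD' N).add hi2) hpt
    _ = 2 * (ε / 4 + C * (1 - P.real G)) := by
        rw [integral_add (hD' N) hi2, h0,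
          integral_const_mul, integral_add (integrable_const _) hind,
          integral_indicator (hms N).compl, setIntegral_const, probReal_compl_eq_one_sub (hms N)]
        simp only [integral_const, probReal_univ, smul_eq_mul]
        ring
    _ < ε := by linarith [hN₀ N hN]

/-- Centering gives every strategy mean loss zero, so an optimal one can gain nothing
asymptotically: each strategy differs from it by a quantity vanishing in `L¹`, including the one
that never bets. -/
theorem EveryFiniteLossHasOptimal.tendsto_integral_abs_average {Ω : Type u}
    {𝒴 mΩ : MeasurableSpace Ω} {P : Measure Ω} [IsProbabilityMeasure P] (h𝒴 : 𝒴 ≤ mΩ)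
    {T : Ω ≃ᵐ Ω} (hT : MeasurePreserving T P P) (h : 𝒴.comap T = 𝒴)
    (hopt : EveryFiniteLossHasOptimal.{u, v} 𝒴 T P) {f : Ω → ℝ} (hf : Measurable[mΩ] f)
    (hf1 : ∀ ω, |f ω| ≤ 1) (hf0 : P[f|𝒴] =ᵐ[P] 0) {s : ℕ → Ω → Bool}
    (hs : ∀ k, Measurable[𝒴] (s k)) :
    Tendsto (fun N : ℕ => ∫ ω, |(1 / (N : ℝ)) * ∑ k ∈ Finset.Icc 1 N,
      (if s k ω then 1 else 0) * f (T^[k] ω)| ∂P) atTop (𝓝 0) := by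
  -- The two-point decision space is lifted to the universe over which decision spaces range.
  let χ : ULift.{v} Bool → ℝ := fun a => if a.down then 1 else 0
  have hχ : ∀ a, 0 ≤ χ a ∧ χ a ≤ 1 := fun a => by simp only [χ]; split_ifs <;> simp
  have hχm : Measurable[⊤] χ := measurable_from_top
  let ℓ : ULift.{v} Bool × Ω → ℝ := fun x => χ x.1 * f x.2
  let mU : MeasurableSpace (ULift.{v} Bool) := ⊤
  obtain ⟨t, ht, hopt'⟩ := @hopt (ULift.{v} Bool) mU _ _ ℓ
    ((hχm.comp measurable_fst).mul (hf.comp measurable_snd))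
    ⟨1, fun a ω => abs_mul_le_one (abs_le.2 ⟨by linarith [hχ a], (hχ a).2⟩) (hf1 ω)⟩
  have hadm : ∀ s : ℕ → Ω → ULift.{v} Bool,
      IsAdmissible 𝒴 T s ↔ ∀ k, 1 ≤ k → Measurable[𝒴] (s k) := fun s =>
    forall₂_congr fun k _ => by rw [observedField_eq_of_comap_eq h]
  have hfk : ∀ k, Measurable[mΩ] fun ω => f (T^[k] ω) := fun k =>
    hf.comp (T.measurable.iterate k)
  have hD : ∀ s : ℕ → Ω → ULift.{v} Bool, IsAdmissible 𝒴 T s →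
      Tendsto (fun N : ℕ => ∫ ω, |averageLoss T ℓ s N ω - averageLoss T ℓ t N ω| ∂P)
        atTop (𝓝 0) ∧
      ∀ N, Integrable (fun ω => averageLoss T ℓ s N ω - averageLoss T ℓ t N ω) P := by
    intro s hs
    have hs' := (hadm s).1 hs
    have ht' := (hadm t).1 ht
    have e : ∀ N ω, averageLoss T ℓ s N ω - averageLoss T ℓ t N ω =
        (1 / (N : ℝ)) * ∑ k ∈ Finset.Icc 1 N, (χ (s k ω) - χ (t k ω)) * f (T^[k] ω) := by
      intro N ω
      simp only [averageLoss, ℓ]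
      rw [← mul_sub, ← Finset.sum_sub_distrib]
      simp only [sub_mul]
    have hw1 : ∀ k ω, |χ (s k ω) - χ (t k ω)| ≤ 1 := fun k ω => abs_le.2
      ⟨by linarith [hχ (s k ω), hχ (t k ω)], by linarith [hχ (s k ω), hχ (t k ω)]⟩
    have hw : ∀ k, 1 ≤ k → Measurable[𝒴] fun ω => χ (s k ω) - χ (t k ω) := fun k hk =>
      (hχm.comp (hs' k hk)).sub (hχm.comp (ht' k hk))
    have hDm : ∀ N, Measurable[mΩ]
        fun ω => averageLoss T ℓ s N ω - averageLoss T ℓ t N ω := by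
      intro N
      simp only [e]
      exact (Finset.measurable_sum _ fun k hk =>
        ((hw k (Finset.mem_Icc.1 hk).1).mono h𝒴 le_rfl).mul (hfk k)).const_mul _
    have hD1 : ∀ N ω, |averageLoss T ℓ s N ω - averageLoss T ℓ t N ω| ≤ 1 := by
      intro N ω
      rw [e]
      exact abs_average_le zero_le_one (fun k => abs_mul_le_one (hw1 k ω) (hf1 _)) N
    refine ⟨tendsto_integral_abs_of_asymptotically_nonneg hDm hD1 (fun N => ?_) (hopt' s hs),
      fun N => integrable_of_abs_le (hDm N) (hD1 N)⟩
    simp only [e]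
    rw [integral_const_mul, integral_finsetSum, Finset.sum_eq_zero, mul_zero]
    · intro k hk
      exact integral_mul_comp_iterate_eq_zero h𝒴 hT h (integrable_of_abs_le hf hf1) hf0
        (hw k (Finset.mem_Icc.1 hk).1) (hw1 k) k
    · intro k hk
      exact integrable_of_abs_le (C := 1)
        (((hw k (Finset.mem_Icc.1 hk).1).mono h𝒴 le_rfl).mul (hfk k))
        fun ω => abs_mul_le_one (hw1 k ω) (hf1 _)
  obtain ⟨l1, i1⟩ := hD (fun k ω => ULift.up (s k ω)) ((hadm _).2 fun k _ =>
    (measurable_from_top (f := fun b : Bool => ULift.up.{v} b)).comp (hs k))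
  obtain ⟨l2, i2⟩ := hD (fun _ _ => ULift.up false) ((hadm _).2 fun k _ => measurable_const)
  have hlim := l1.add l2
  rw [add_zero] at hlim
  refine squeeze_zero (fun N => integral_nonneg fun ω => abs_nonneg _) (fun N => ?_) hlim
  rw [← integral_add (i1 N).abs (i2 N).abs]
  refine integral_mono_of_nonneg (Eventually.of_forall fun ω => abs_nonneg _)
    ((i1 N).abs.add (i2 N).abs) (Eventually.of_forall fun ω => ?_)
  have e0 : averageLoss T ℓ (fun _ _ => ULift.up false) N ω = 0 := by simp [averageLoss, ℓ, χ]
  have e1 : averageLoss T ℓ (fun k ω => ULift.up (s k ω)) N ω =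
      (1 / (N : ℝ)) * ∑ k ∈ Finset.Icc 1 N, (if s k ω then 1 else 0) * f (T^[k] ω) := rfl
  simp only
  rw [← e1, e0, zero_sub, abs_neg]
  have := abs_add_le (averageLoss T ℓ (fun k ω => ULift.up (s k ω)) N ω - averageLoss T ℓ t N ω)
    (averageLoss T ℓ t N ω)
  rwa [sub_add_cancel] at this

/-! ### Testing against a conditionally independent copy of the itinerary. -/

/-- A conditionally independent copy of a binary sequence given `𝒴`, realized by independent
uniform randomization. -/
theorem exists_randomized_copy {Ω : Type u} {𝒴 mΩ : MeasurableSpace Ω} {P : Measure Ω}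
    [IsFiniteMeasure P] (h𝒴 : 𝒴 ≤ mΩ) {ξ : Ω → ℕ → Bool} (hξ : Measurable[mΩ] ξ) :
    ∃ c : Ω → unitInterval → ℕ → Bool,
      Measurable[𝒴.prod inferInstance] (Function.uncurry c) ∧
      ∀ φ : (ℕ → Bool) → ℝ, Measurable φ → ∀ C : ℝ, (∀ y, |φ y| ≤ C) →
        P[fun ω => φ (ξ ω)|𝒴] =ᵐ[P] fun ω => ∫ r, φ (c ω r) := by
  -- Conditioning on `𝒴` is conditioning on the identity map into `(Ω, 𝒴)`. The resulting kernel
  -- into the standard Borel space `ℕ → Bool` is then realized as an image of the uniform law.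
  have hid : Measurable[mΩ, 𝒴] (id : Ω → Ω) := measurable_id'' h𝒴
  obtain ⟨c, hc, hcκ⟩ := Kernel.exists_measurable_map_eq_unitInterval
    (@condDistrib Ω Ω (ℕ → Bool) _ _ _ mΩ 𝒴 ξ id P _)
  refine ⟨c, hc, fun φ hφ C hC => ?_⟩
  have key := condExp_ae_eq_integral_condDistrib (mβ := 𝒴) hid hξ.aemeasurable (μ := P)
    hφ.stronglyMeasurable (integrable_of_abs_le (hφ.comp hξ) fun ω => hC _)
  rw [MeasurableSpace.comap_id] at key
  refine key.trans (Eventually.of_forall fun ω => ?_)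
  simp only [id]
  rw [← hcκ ω, integral_map _ hφ.aestronglyMeasurable]
  exact (hc.comp measurable_prodMk_left).aemeasurable

/-- If the bets follow a conditionally independent copy of the itinerary, the `(j, k)` term of the
second moment is the integral of `P[X_j X_k|𝒴] · cov j k`, where `X_j` is the indicator of `A` at
time `j`. As `P[X_j X_k|𝒴]` is `cov j k` plus the product of the conditional probabilities, the
square of the covariance appears. -/
theorem EveryFiniteLossHasOptimal.tendsto_average_sq_condCov {Ω : Type u}
    {𝒴 mΩ : MeasurableSpace Ω} {P : Measure Ω} [IsProbabilityMeasure P] (h𝒴 : 𝒴 ≤ mΩ)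
    {T : Ω ≃ᵐ Ω} (hT : MeasurePreserving T P P) (h : 𝒴.comap T = 𝒴)
    (hopt : EveryFiniteLossHasOptimal.{u, v} 𝒴 T P) {A : Set Ω} (hA : MeasurableSet[mΩ] A)
    {g f : Ω → ℝ} (hg : Measurable[𝒴] g) (hg1 : ∀ ω, 0 ≤ g ω ∧ g ω ≤ 1)
    (hge : g =ᵐ[P] P⟦A|𝒴⟧) (hfdef : ∀ ω, f ω = A.indicator (fun _ => (1 : ℝ)) ω - g ω) :
    Tendsto (fun N : ℕ => (1 / (N : ℝ)) ^ 2 *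
      ∑ j ∈ Finset.Icc 1 N, ∑ k ∈ Finset.Icc 1 N,
        ∫ ω, (P[fun ω => f (T^[j] ω) * f (T^[k] ω)|𝒴]) ω ^ 2 ∂P) atTop (𝓝 0) := by
  classical
  have hfe : f = fun ω => A.indicator (fun _ => (1 : ℝ)) ω - g ω := funext hfdef
  have hg' : Measurable[mΩ] g := hg.mono h𝒴 le_rfl
  have hga : ∀ ω, |g ω| ≤ 1 := fun ω => abs_le.2 ⟨by linarith [(hg1 ω).1], (hg1 ω).2⟩
  have hXi : Integrable (A.indicator fun _ => (1 : ℝ)) P := (integrable_const _).indicator hA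
  have hXm : Measurable[mΩ] (A.indicator fun _ => (1 : ℝ)) := measurable_const.indicator hA
  have hf : Measurable[mΩ] f := hfe ▸ hXm.sub hg'
  have hf1 : ∀ ω, |f ω| ≤ 1 := fun ω => hfdef ω ▸ abs_indicator_sub_le A hg1 ω
  have hf0 : P[f|𝒴] =ᵐ[P] 0 := by
    have e1 := condExp_sub hXi (integrable_of_abs_le hg' hga) 𝒴
    have e2 : P[g|𝒴] = g := condExp_of_stronglyMeasurable h𝒴 hg.stronglyMeasurable
      (integrable_of_abs_le hg' hga)
    rw [hfe]
    filter_upwards [e1, hge] with ω h1 h2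
    refine h1.trans ?_
    rw [Pi.sub_apply, e2, h2, sub_self, Pi.zero_apply]
  have hfk : ∀ k, Measurable[mΩ] fun ω => f (T^[k] ω) := fun k =>
    hf.comp (T.measurable.iterate k)
  have hgk : ∀ k, Measurable[𝒴] fun ω => g (T^[k] ω) := fun k =>
    hg.comp (measurable_iterate_of_comap_eq h k)
  set cov : ℕ → ℕ → Ω → ℝ := fun j k => P[fun ω => f (T^[j] ω) * f (T^[k] ω)|𝒴] with hcov
  have hcovi : ∀ j k, Integrable (cov j k) P := fun j k => integrable_condExp
  have hcov1 : ∀ j k, ∀ᵐ ω ∂P, |cov j k ω| ≤ 1 := fun j k =>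
    ae_bdd_abs_condExp_of_ae_bdd_abs (R := 1)
      (Eventually.of_forall fun ω => abs_mul_le_one (hf1 _) (hf1 _))
  -- a randomized copy of the itinerary
  let ξ : Ω → ℕ → Bool := fun ω k => decide (T^[k] ω ∈ A)
  have hξ : Measurable[mΩ] ξ := measurable_pi_iff.2 fun k =>
    measurable_to_bool (by
      have : (fun ω => ξ ω k) ⁻¹' {true} = T^[k] ⁻¹' A := by ext ω; simp [ξ]
      rw [this]
      exact T.measurable.iterate k hA)
  obtain ⟨c, hc, hcξ⟩ := exists_randomized_copy (P := P) h𝒴 hξ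
  let χ : Bool → ℝ := fun b => if b then 1 else 0
  have hχ1 : ∀ b, |χ b| ≤ 1 := fun b => by cases b <;> simp [χ]
  have hχm : Measurable χ := measurable_from_top
  have hcr : ∀ r k, Measurable[𝒴] fun ω => c ω r k := fun r k =>
    (measurable_pi_apply k).comp (hc.comp measurable_prodMk_right)
  have hc' : Measurable[mΩ.prod inferInstance] (Function.uncurry c) :=
    hc.comp ((measurable_id'' h𝒴).prodMap measurable_id)
  have hcω : ∀ k, Measurable[Prod.instMeasurableSpace]
      fun x : unitInterval × Ω => χ (c x.2 x.1 k) := fun k =>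
    hχm.comp ((measurable_pi_apply k).comp (hc'.comp measurable_swap))
  let F : ℕ → unitInterval → Ω → ℝ := fun N r ω =>
    (1 / (N : ℝ)) * ∑ k ∈ Finset.Icc 1 N, χ (c ω r k) * f (T^[k] ω)
  have hFm : ∀ N, Measurable fun x : unitInterval × Ω => F N x.1 x.2 := fun N =>
    (Finset.measurable_sum _ fun k _ =>
      (hcω k).mul ((hfk k).comp measurable_snd)).const_mul _
  have hF1 : ∀ N r ω, |F N r ω| ≤ 1 := fun N r ω =>
    abs_average_le zero_le_one (fun k => abs_mul_le_one (hχ1 _) (hf1 _)) N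
  have hF2 : ∀ N r ω, F N r ω ^ 2 ≤ |F N r ω| := fun N r ω => by
    rw [← sq_abs, sq]
    exact mul_le_of_le_one_left (abs_nonneg _) (hF1 N r ω)
  have hFr : ∀ N r, Measurable[mΩ] (F N r) := fun N r => (hFm N).comp measurable_prodMk_left
  have hFi : ∀ N r, Integrable (fun ω => F N r ω ^ 2) P := fun N r =>
    integrable_of_abs_le ((hFr N r).pow_const 2) (C := 1) fun ω => by
      rw [abs_pow]; exact pow_le_one₀ (abs_nonneg _) (hF1 N r ω)
  -- For each fixed seed `r` the copy is a genuine `𝒴`-measurable strategy, so the inner integral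
  -- tends to zero; it is bounded by `1`, and dominated convergence averages over `r`.
  have hlim : Tendsto (fun N => ∫ r, ∫ ω, F N r ω ^ 2 ∂P) atTop (𝓝 0) := by
    have := tendsto_integral_of_dominated_convergence (μ := (volume : Measure unitInterval))
      (F := fun N r => ∫ ω, F N r ω ^ 2 ∂P) (f := fun _ => 0) (fun _ => (1 : ℝ))
      (fun N => ?_) (integrable_const _) (fun N => Eventually.of_forall fun r => ?_)
      (Eventually.of_forall fun r => ?_)
    · simpa using this
    · exact (((hFm N).pow_const 2).stronglyMeasurable.integral_prod_right).aestronglyMeasurable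
    · rw [Real.norm_of_nonneg (integral_nonneg fun ω => sq_nonneg _)]
      calc _ ≤ ∫ ω, (1 : ℝ) ∂P := integral_mono (hFi N r) (integrable_const _)
            fun ω => (hF2 N r ω).trans (hF1 N r ω)
        _ = 1 := by simp
    · exact squeeze_zero (fun N => integral_nonneg fun ω => sq_nonneg _)
        (fun N => integral_mono (hFi N r) (integrable_of_abs_le (hFr N r) (hF1 N r)).abs
          fun ω => hF2 N r ω)
        (hopt.tendsto_integral_abs_average h𝒴 hT h hf hf1 hf0 (hcr r))
  -- the second moment of the randomized average
  have hjk : ∀ j k, ∫ r, ∫ ω, χ (c ω r j) * χ (c ω r k) * cov j k ω ∂P =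
      ∫ ω, cov j k ω ^ 2 ∂P + ∫ ω, g (T^[j] ω) * g (T^[k] ω) * cov j k ω ∂P := by
    intro j k
    have e := hcξ (fun y => χ (y j) * χ (y k))
      ((hχm.comp (measurable_pi_apply j)).mul (hχm.comp (measurable_pi_apply k))) 1
      fun y => abs_mul_le_one (hχ1 _) (hχ1 _)
    have hp : ∀ k, (fun ω => g (T^[k] ω)) =ᵐ[P]
        P[(A.indicator fun _ => (1 : ℝ)) ∘ T^[k]|𝒴] := fun k =>
      ((hT.iterate k).quasiMeasurePreserving.ae_eq_comp hge).trans
        (condExp_comp_of_comap_eq h𝒴 (hT.iterate k) (comap_iterate_eq h k) hXi).symm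
    have e2 := condExp_centered_mul (P := P) h𝒴
      (X := (A.indicator fun _ => (1 : ℝ)) ∘ T^[j]) (Y := (A.indicator fun _ => (1 : ℝ)) ∘ T^[k])
      (hXm.comp (T.measurable.iterate j)) (fun ω => abs_indicator_one_le A _)
      (hXm.comp (T.measurable.iterate k)) (fun ω => abs_indicator_one_le A _)
      (hgk j) (fun ω => hga _) (hgk k) (fun ω => hga _) (hp j) (hp k)
    have e3 : (fun ω => (((A.indicator fun _ => (1 : ℝ)) ∘ T^[j]) ω - g (T^[j] ω)) *
        (((A.indicator fun _ => (1 : ℝ)) ∘ T^[k]) ω - g (T^[k] ω))) =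
        fun ω => f (T^[j] ω) * f (T^[k] ω) := by
      ext ω; rw [hfdef, hfdef]; rfl
    have e4 : (fun ω => χ (ξ ω j) * χ (ξ ω k)) = fun ω =>
        ((A.indicator fun _ => (1 : ℝ)) ∘ T^[j]) ω * ((A.indicator fun _ => (1 : ℝ)) ∘ T^[k]) ω := by
      ext ω; simp [χ, ξ, Set.indicator]
    rw [e3] at e2
    rw [e4] at e
    have hI : Integrable (Function.uncurry fun (r : unitInterval) (ω : Ω) =>
        χ (c ω r j) * χ (c ω r k) * cov j k ω) (volume.prod P) :=
      ((hcovi j k).comp_snd volume).bdd_mul (((hcω j).mul (hcω k)).aestronglyMeasurable)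
        (Eventually.of_forall fun x => abs_mul_le_one (hχ1 _) (hχ1 _))
    have i1 : Integrable (fun ω => cov j k ω ^ 2) P := by
      simp only [sq]
      exact (hcovi j k).bdd_mul (hcovi j k).1 (hcov1 j k)
    have i2 : Integrable (fun ω => g (T^[j] ω) * g (T^[k] ω) * cov j k ω) P :=
      (hcovi j k).bdd_mul (((hgk j).mul (hgk k)).mono h𝒴 le_rfl).aestronglyMeasurable
        (Eventually.of_forall fun ω => abs_mul_le_one (hga _) (hga _))
    -- Integrating over `r` first replaces the copy's product by the conditional expectation of the
    -- itinerary's product, `cov` being `𝒴`-measurable and free of `r`.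
    rw [integral_integral_swap hI, ← integral_add i1 i2]
    refine integral_congr_ae ?_
    filter_upwards [e, e2] with ω h1 h2
    rw [integral_mul_const, ← h1, sq, ← add_mul]
    congr 1
    rw [hcov]
    simp only
    rw [h2]
    ring
  refine squeeze_zero (fun N => mul_nonneg (by positivity) (Finset.sum_nonneg fun j _ =>
    Finset.sum_nonneg fun k _ => integral_nonneg fun ω => sq_nonneg _)) (fun N => ?_) hlim
  have hG := integral_sq_sum_eq (P := P) h𝒴 hgk (fun k ω => hga _) hfk (fun k ω => hf1 _)
    (Finset.Icc 1 N)
  have hFr2 : ∀ r, ∫ ω, F N r ω ^ 2 ∂P = (1 / (N : ℝ)) ^ 2 * ∑ j ∈ Finset.Icc 1 N,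
      ∑ k ∈ Finset.Icc 1 N, ∫ ω, χ (c ω r j) * χ (c ω r k) * cov j k ω ∂P := fun r => by
    simp only [F, mul_pow]
    rw [integral_const_mul, integral_sq_sum_eq (P := P) h𝒴
      (s := fun k ω => χ (c ω r k)) (fun k => hχm.comp (hcr r k))
      (fun k ω => hχ1 _) hfk (fun k ω => hf1 _) (Finset.Icc 1 N)]
  have hir : ∀ j k, Integrable
      (fun r => ∫ ω, χ (c ω r j) * χ (c ω r k) * cov j k ω ∂P) volume := fun j k =>
    Integrable.integral_prod_left (f := fun x : unitInterval × Ω =>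
        χ (c x.2 x.1 j) * χ (c x.2 x.1 k) * cov j k x.2) <|
      ((hcovi j k).comp_snd volume).bdd_mul (((hcω j).mul (hcω k)).aestronglyMeasurable)
        (Eventually.of_forall fun x => abs_mul_le_one (hχ1 _) (hχ1 _))
  simp only [hFr2]
  rw [integral_const_mul, integral_finsetSum _ fun j _ => integrable_finsetSum _ fun k _ => hir j k]
  refine mul_le_mul_of_nonneg_left ?_ (by positivity)
  have hsum : ∑ j ∈ Finset.Icc 1 N, ∫ r, ∑ k ∈ Finset.Icc 1 N,
      ∫ ω, χ (c ω r j) * χ (c ω r k) * cov j k ω ∂P =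
      ∑ j ∈ Finset.Icc 1 N, ∑ k ∈ Finset.Icc 1 N, ∫ ω, cov j k ω ^ 2 ∂P +
      ∑ j ∈ Finset.Icc 1 N, ∑ k ∈ Finset.Icc 1 N,
        ∫ ω, g (T^[j] ω) * g (T^[k] ω) * cov j k ω ∂P := by
    rw [← Finset.sum_add_distrib]
    refine Finset.sum_congr rfl fun j _ => ?_
    rw [integral_finsetSum _ fun k _ => hir j k, ← Finset.sum_add_distrib]
    exact Finset.sum_congr rfl fun k _ => hjk j k
  rw [hsum]
  -- The discarded term is the second moment of the sum of `g ∘ T^[k] · f ∘ T^[k]`, hence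
  -- nonnegative.
  refine le_add_of_nonneg_right ?_
  rw [← hG]
  exact integral_nonneg fun ω => sq_nonneg _

/-! ### From autocovariances to conditional weak mixing. -/

theorem tendsto_average_integral_abs_of_sq {Ω : Type u} {mΩ : MeasurableSpace Ω} {P : Measure Ω}
    [IsProbabilityMeasure P] {c : ℕ → ℕ → Ω → ℝ} (hc : ∀ j k, Integrable (c j k) P)
    (hc2 : ∀ j k, Integrable (fun ω => c j k ω ^ 2) P)
    (h : Tendsto (fun N : ℕ => (1 / (N : ℝ)) ^ 2 *
      ∑ j ∈ Finset.Icc 1 N, ∑ k ∈ Finset.Icc 1 N, ∫ ω, c j k ω ^ 2 ∂P) atTop (𝓝 0)) :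
    Tendsto (fun N : ℕ => (1 / (N : ℝ)) ^ 2 *
      ∑ j ∈ Finset.Icc 1 N, ∑ k ∈ Finset.Icc 1 N, ∫ ω, |c j k ω| ∂P) atTop (𝓝 0) := by
  refine tendsto_zero_of_le_add_div (fun N => mul_nonneg (by positivity) (Finset.sum_nonneg
    fun j _ => Finset.sum_nonneg fun k _ => integral_nonneg fun ω => abs_nonneg _)) ?_ h
  intro ε hε N
  have key : ∀ j k, ∫ ω, |c j k ω| ∂P ≤ ε + (∫ ω, c j k ω ^ 2 ∂P) / ε := fun j k => by
    calc _ ≤ ∫ ω, (ε + c j k ω ^ 2 / ε) ∂P :=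
          integral_mono (hc j k).abs ((integrable_const _).add ((hc2 j k).div_const _))
            fun ω => abs_le_add_sq_div hε _
      _ = _ := by
          rw [integral_add (integrable_const _) ((hc2 j k).div_const _), integral_div]
          simp
  calc _ ≤ (1 / (N : ℝ)) ^ 2 * ∑ j ∈ Finset.Icc 1 N, ∑ k ∈ Finset.Icc 1 N,
        (ε + (∫ ω, c j k ω ^ 2 ∂P) / ε) :=
        mul_le_mul_of_nonneg_left (Finset.sum_le_sum fun j _ => Finset.sum_le_sum fun k _ =>
          key j k) (by positivity)
    _ = (1 / (N : ℝ)) ^ 2 * (N : ℝ) ^ 2 * ε + ((1 / (N : ℝ)) ^ 2 *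
        ∑ j ∈ Finset.Icc 1 N, ∑ k ∈ Finset.Icc 1 N, ∫ ω, c j k ω ^ 2 ∂P) / ε := by
        simp only [Finset.sum_add_distrib, Finset.sum_const, Nat.card_Icc, Nat.add_sub_cancel,
          nsmul_eq_mul, ← Finset.sum_div]
        ring
    _ ≤ _ := by
        refine add_le_add (mul_le_of_le_one_left hε.le ?_) le_rfl
        rw [← mul_pow]
        rcases Nat.eq_zero_or_pos N with rfl | hN
        · simp
        · rw [one_div_mul_cancel (by positivity), one_pow]

/-- Vanishing averaged conditional autocovariances of `b` force vanishing averaged conditional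
covariances of `b` with any bounded function. -/
theorem tendsto_average_integral_abs_condExp_mul {Ω : Type u} {𝒴 mΩ : MeasurableSpace Ω}
    {P : Measure Ω} [IsProbabilityMeasure P] (h𝒴 : 𝒴 ≤ mΩ) {a : Ω → ℝ} {b : ℕ → Ω → ℝ}
    (ha : Measurable[mΩ] a) (ha1 : ∀ ω, |a ω| ≤ 1) (hb : ∀ k, Measurable[mΩ] (b k))
    (hb1 : ∀ k ω, |b k ω| ≤ 1)
    (h : Tendsto (fun N : ℕ => (1 / (N : ℝ)) ^ 2 * ∑ j ∈ Finset.Icc 1 N, ∑ k ∈ Finset.Icc 1 N,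
      ∫ ω, |(P[fun ω => b j ω * b k ω|𝒴]) ω| ∂P) atTop (𝓝 0)) :
    Tendsto (fun N : ℕ => (1 / (N : ℝ)) * ∑ k ∈ Finset.Icc 1 N,
      ∫ ω, |(P[fun ω => a ω * b k ω|𝒴]) ω| ∂P) atTop (𝓝 0) := by
  -- The sign of the conditional covariance is a `𝒴`-measurable weight. It turns the sum of absolute
  -- covariances into the single integral of `a * F N`, to which the second moment bound applies.
  let s : ℕ → Ω → ℝ := fun k ω => if 0 ≤ (P[fun ω => a ω * b k ω|𝒴]) ω then 1 else -1
  have hs : ∀ k, Measurable[𝒴] (s k) := fun k =>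
    Measurable.ite (measurableSet_le measurable_const stronglyMeasurable_condExp.measurable)
      measurable_const measurable_const
  have hs1 : ∀ k ω, |s k ω| ≤ 1 := fun k ω => by simp only [s]; split_ifs <;> simp
  let F : ℕ → Ω → ℝ := fun N ω => (1 / (N : ℝ)) * ∑ k ∈ Finset.Icc 1 N, s k ω * b k ω
  have hFm : ∀ N, Measurable[mΩ] (F N) := fun N =>
    (Finset.measurable_sum _ fun k _ => ((hs k).mono h𝒴 le_rfl).mul (hb k)).const_mul _
  have hF1 : ∀ N ω, |F N ω| ≤ 1 := fun N ω =>
    abs_average_le zero_le_one (fun k => abs_mul_le_one (hs1 k ω) (hb1 k ω)) N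
  have hFi := fun N => integrable_of_abs_le (P := P) (hFm N) (hF1 N)
  have hF2 : Tendsto (fun N => ∫ ω, F N ω ^ 2 ∂P) atTop (𝓝 0) := by
    refine squeeze_zero (fun N => integral_nonneg fun ω => sq_nonneg _) (fun N => ?_) h
    simp only [F, mul_pow]
    rw [integral_const_mul]
    exact mul_le_mul_of_nonneg_left (integral_sq_sum_le h𝒴 hs hs1 hb hb1 _) (by positivity)
  have hF := tendsto_integral_abs_of_sq hFi (fun N => integrable_of_abs_le (C := 1)
    ((hFm N).pow_const 2) fun ω => by
      rw [abs_pow]; exact pow_le_one₀ (abs_nonneg _) (hF1 N ω)) hF2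
  have hab : ∀ k, Integrable (fun ω => a ω * b k ω) P := fun k =>
    integrable_of_abs_le (ha.mul (hb k)) fun ω => abs_mul_le_one (ha1 ω) (hb1 k ω)
  have hsab : ∀ k, Integrable (fun ω => s k ω * (a ω * b k ω)) P := fun k =>
    (hab k).bdd_mul ((hs k).mono h𝒴 le_rfl).aestronglyMeasurable (Eventually.of_forall (hs1 k))
  refine squeeze_zero (fun N => mul_nonneg (by positivity) (Finset.sum_nonneg
    fun k _ => integral_nonneg fun ω => abs_nonneg _)) (fun N => ?_) hF
  calc _ = (1 / (N : ℝ)) * ∑ k ∈ Finset.Icc 1 N, ∫ ω, s k ω * (a ω * b k ω) ∂P := by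
        congr 1
        refine Finset.sum_congr rfl fun k _ => ?_
        rw [← integral_mul_condExp h𝒴 (hs k) (hs1 k) (hab k)]
        refine integral_congr_ae (Eventually.of_forall fun ω => ?_)
        simp only [s]
        split_ifs with h0
        · rw [abs_of_nonneg h0, one_mul]
        · rw [abs_of_neg (not_le.1 h0), neg_one_mul]
    _ = ∫ ω, a ω * F N ω ∂P := by
        rw [← integral_finsetSum _ fun k _ => hsab k, ← integral_const_mul]
        refine integral_congr_ae (Eventually.of_forall fun ω => ?_)
        simp only [F]
        rw [mul_left_comm, Finset.mul_sum, Finset.mul_sum, Finset.mul_sum]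
        exact Finset.sum_congr rfl fun k _ => by ring
    _ ≤ ∫ ω, |F N ω| ∂P := by
        refine integral_mono ((hFi N).bdd_mul ha.aestronglyMeasurable
          (Eventually.of_forall ha1)) (hFi N).abs fun ω => (le_abs_self _).trans ?_
        rw [abs_mul]
        exact mul_le_of_le_one_left (abs_nonneg _) (ha1 ω)

theorem EveryFiniteLossHasOptimal.isCondWeakMixing {Ω : Type u}
    {𝒴 mΩ : MeasurableSpace Ω} {P : Measure Ω} [IsProbabilityMeasure P] (h𝒴 : 𝒴 ≤ mΩ)
    {T : Ω ≃ᵐ Ω} (hT : MeasurePreserving T P P) (h : 𝒴.comap T = 𝒴)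
    (hopt : EveryFiniteLossHasOptimal.{u, v} 𝒴 T P) : IsCondWeakMixing 𝒴 T P := by
  intro A B hA hB
  obtain ⟨gA, hgA, hgA1, hgAe⟩ := exists_condProb_version P h𝒴 hA
  obtain ⟨gB, hgB, hgB1, hgBe⟩ := exists_condProb_version P h𝒴 hB
  let f : Ω → ℝ := fun ω => B.indicator (fun _ => (1 : ℝ)) ω - gB ω
  have hf : Measurable[mΩ] f := (measurable_const.indicator hB).sub (hgB.mono h𝒴 le_rfl)
  have hf1 : ∀ ω, |f ω| ≤ 1 := abs_indicator_sub_le B hgB1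
  have hsq := hopt.tendsto_average_sq_condCov h𝒴 hT h hB hgB hgB1 hgBe (f := f) fun _ => rfl
  have habs := tendsto_average_integral_abs_of_sq
    (c := fun j k => P[fun ω => f (T^[j] ω) * f (T^[k] ω)|𝒴])
    (fun j k => integrable_condExp) (fun j k => by
      simp only [sq]
      exact integrable_condExp.bdd_mul integrable_condExp.1
        (ae_bdd_abs_condExp_of_ae_bdd_abs (R := 1)
          (Eventually.of_forall fun ω => abs_mul_le_one (hf1 _) (hf1 _)))) hsq
  have hlim := tendsto_average_integral_abs_condExp_mul (P := P) h𝒴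
    (a := fun ω => A.indicator (fun _ => (1 : ℝ)) ω - gA ω) (b := fun k ω => f (T.symm^[k] ω))
    ((measurable_const.indicator hA).sub (hgA.mono h𝒴 le_rfl)) (abs_indicator_sub_le A hgA1)
    (fun k => hf.comp (T.symm.measurable.iterate k)) (fun k ω => hf1 _)
    -- The strategies control forward times; time reversal carries the bound over to the backward
    -- times in `TᵏB`.
    (by simpa only [integral_abs_condExp_symm_iterate_mul_eq h𝒴 hT h hf hf1] using habs)
  have := ENNReal.tendsto_ofReal hlim
  rw [ENNReal.ofReal_zero] at this
  refine this.congr fun N => ?_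
  exact (eLpNorm_average_condCov_eq h𝒴 hT h hA hB hgA hgA1 hgAe hgB hgB1 hgBe N).symm

theorem isCondWeakMixing_iff_everyFiniteLossHasOptimal {Ω : Type u}
    {𝒴 mΩ : MeasurableSpace Ω} {P : Measure Ω} [IsProbabilityMeasure P] (h𝒴 : 𝒴 ≤ mΩ)
    {T : Ω ≃ᵐ Ω} (hT : MeasurePreserving T P P) (h : 𝒴.comap T = 𝒴) :
    IsCondWeakMixing 𝒴 T P ↔ EveryFiniteLossHasOptimal.{u, v} 𝒴 T P :=
  ⟨fun hwm => hwm.everyFiniteLossHasOptimal h𝒴 hT h, fun hopt => hopt.isCondWeakMixing h𝒴 hT h⟩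

/-! ### The trivial σ-field and the main theorem. -/

theorem isWeakMixing_iff_isCondWeakMixing_bot {Ω : Type u} {mΩ : MeasurableSpace Ω}
    {P : Measure Ω} [IsProbabilityMeasure P] {T : Ω ≃ᵐ Ω} (hT : MeasurePreserving T P P) :
    IsWeakMixing T P ↔ IsCondWeakMixing ⊥ T P := by
  refine forall₄_congr fun A B hA hB => ?_
  have hT' : ∀ k, MeasurableSet (T^[k] '' B) ∧ P.real (T^[k] '' B) = P.real B ∧
      P.real (A ∩ T^[k] '' B) = P.real (T^[k] ⁻¹' A ∩ B) := by
    intro k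
    have hinj : Function.Injective T^[k] := T.injective.iterate k
    have e : T^[k] '' B = T.symm^[k] ⁻¹' B := congrFun (Set.image_eq_preimage_of_inverse
      (Function.LeftInverse.iterate T.symm_apply_apply k)
      (Function.LeftInverse.iterate T.apply_symm_apply k)) B
    have hm : MeasurableSet (T^[k] '' B) := e ▸ T.symm.measurable.iterate k hB
    have hpre : ∀ s, MeasurableSet s → P.real (T^[k] ⁻¹' s) = P.real s := fun s hs =>
      (hT.iterate k).measureReal_preimage hs.nullMeasurableSet
    refine ⟨hm, ?_, ?_⟩
    · rw [← hpre _ hm, Set.preimage_image_eq _ hinj]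
    -- Pulling `A ∩ TᵏB` back by `Tᵏ` gives `T⁻ᵏA ∩ B`, which matches the two mixing conventions.
    · rw [← hpre _ (hA.inter hm), Set.preimage_inter, Set.preimage_image_eq _ hinj]
  have hc : ∀ s, MeasurableSet s → P⟦s|⊥⟧ = fun _ => P.real s := fun s hs => by
    rw [condExp_bot, integral_indicator_const _ hs, smul_eq_mul, mul_one]
  have hN : ∀ N : ℕ, eLpNorm (fun ω => (1 / (N : ℝ)) * ∑ k ∈ Finset.Icc 1 N,
      |(P⟦A ∩ T^[k] '' B|⊥⟧) ω - (P⟦A|⊥⟧) ω * (P⟦T^[k] '' B|⊥⟧) ω|) 1 P =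
      ENNReal.ofReal ((1 / (N : ℝ)) * ∑ k ∈ Finset.Icc 1 N,
        |P.real (T^[k] ⁻¹' A ∩ B) - P.real A * P.real B|) := by
    intro N
    have e : (fun ω => (1 / (N : ℝ)) * ∑ k ∈ Finset.Icc 1 N,
        |(P⟦A ∩ T^[k] '' B|⊥⟧) ω - (P⟦A|⊥⟧) ω * (P⟦T^[k] '' B|⊥⟧) ω|) =
        fun _ => (1 / (N : ℝ)) * ∑ k ∈ Finset.Icc 1 N,
          |P.real (T^[k] ⁻¹' A ∩ B) - P.real A * P.real B| := by
      ext ω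
      congr 1
      refine Finset.sum_congr rfl fun k _ => ?_
      rw [hc _ (hA.inter (hT' k).1), hc _ hA, hc _ (hT' k).1, (hT' k).2.1, (hT' k).2.2]
    rw [e, eLpNorm_one_eq_ofReal_integral (integrable_const _) fun ω => by positivity]
    simp
  simp only [hN]
  constructor
  · intro hlim
    simpa using ENNReal.tendsto_ofReal hlim
  · intro hlim
    have := (ENNReal.tendsto_toReal ENNReal.zero_ne_top).comp hlim
    rw [ENNReal.toReal_zero] at this
    refine this.congr fun N => ENNReal.toReal_ofReal (by positivity)

theorem mainTheorem4 {Ω : Type u} {mΩ : MeasurableSpace Ω} (P : Measure Ω)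
    (hP : IsStandardProbabilitySpace P) (T : Ω ≃ᵐ Ω) (hT : Ergodic T P) :
    (∀ 𝒴 : MeasurableSpace Ω, 𝒴 ≤ mΩ → 𝒴.comap T = 𝒴 →
      (IsCondWeakMixing 𝒴 T P ↔ EveryFiniteLossHasOptimal.{u, v} 𝒴 T P)) ∧
    (IsWeakMixing T P ↔ EveryFiniteLossHasOptimal.{u, v} ⊥ T P) := by
  have := hP.1
  have hT' := hT.toMeasurePreserving
  exact ⟨fun 𝒴 h𝒴 h => isCondWeakMixing_iff_everyFiniteLossHasOptimal h𝒴 hT' h,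
    (isWeakMixing_iff_isCondWeakMixing_bot hT').trans
      (isCondWeakMixing_iff_everyFiniteLossHasOptimal bot_le hT' MeasurableSpace.comap_bot)⟩
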